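/- Let $b\ge 1$ and consider the full $b$-ary tree whose level $t$ has $b^t$ nodes. To every node $v$ assign a Clifford unitary $U_v$ on $b$ qubits, i.e. a unitary such that $U_vPU_v^\dagger$ is a Pauli operator for every Pauli operator $P$ (an element of $\{\eta P_1\otimes\cdots\otimes P_b:\ \eta\in\{\pm1,\pm i\},\ P_k\in\{I,\sigma_x,\sigma_y,\sigma_z\}\}$); the unitaries may differ from node to node. Let $V_v:\mathbb C^2\to(\mathbb C^2)^{\otimes b}$, $V_v|\psi\rangle=U_v(|\psi\rangle\otimes|0\rangle^{\otimes(b-1)})$, be the resulting encoders, let $W_t=\bigotimes_{v\text{ at level }t}V_v:(\mathbb C^2)^{\otimes b^t}\to(\mathbb C^2)^{\otimes b^{t+1}}$ (the $j$-th output qubit of $V_v$ being the qubit at the $j$-th child of $v$), and let $V_T=W_{T-1}\cdots W_1W_0$ be the depth-$T$ concatenated encoder, with $V_0=I$. For a single-qubit channel $\mathcal N$ let $$\mathcal E_0=\mathrm{id},\qquad \mathcal E_{t+1}(\rho)=\mathcal N^{\otimes b^{t+1}}\big(W_t\,\mathcal E_t(\rho)\,W_t^\dagger\big)$$ define the noisy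 tree channel $\mathcal E_T$. For $w\in\{x,y,z\}$ let $\mathcal D_w(\rho)=(\rho+\sigma_w\rho\sigma_w)/2$. The weight of a Pauli operator is the number of qubits on which it is not a multiple of the identity. The diamond norm of a superoperator $\Phi$ on a system $S$ is $\|\Phi\|_\diamond=\max_\rho\|(\Phi\otimes\mathrm{id}_R)(\rho)\|_1$, over the states $\rho$ of $S\otimes R$ with $\dim R=\dim S$, where $\|\cdot\|_1$ is the trace norm. Let $T\ge0$, $w\in\{x,y,z\}$, and let $L_w[T]$ be any Pauli operator on $b^T$ qubits that is a logical $\sigma_w$ operator, i.e. $L_w[T]\,V_T=V_T\,\sigma_w$. Then $$\big\|\mathcal E_T-\mathcal E_T\circ\mathcal D_w\big\|_\diamond^2\le 2\, r(T)\,\mathrm{weight}(L_w[T])$$ in each of the following two cases. (i) $\mathcal N$ is the depolarizing channel $\mathcal M_\epsilon(\rho)=(1-\epsilon)\rho+\epsilon\,\mathrm{Tr}(\rho)\,I/2$ with $0\le\epsilon\le1$, and $r(T)=(1-\epsilon)^T$. (ii) $w\in\{x,z\}$, $\mathcal N=\mathcal N_z\circ\mathcal N_x$ with $\mathcal N_u(\rho)=(1-p)\rho+p\,\sigma_u\rho\sigma_u$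 and $0\le p\le1$, $r(T)=(1-2p)^{2T}$, and there is a chain of Pauli operators $L_w[0],L_w[1],\dots,L_w[T]$ ending in the given $L_w[T]$, with $L_w[t]$ acting on $b^t$ qubits, such that $L_w[0]=\sigma_w$, no $L_w[t]$ acts as $\sigma_y$ on any qubit (each is, up to a phase in $\{\pm1,\pm i\}$, a tensor product of $I$, $\sigma_x$, $\sigma_z$), and $L_w[t+1]\,W_t=W_t\,L_w[t]$ for $0\le t<T$. -/

import Mathlib

open scoped Matrix ComplexOrder

noncomputable section

namespace QTree

/-! ### Pauli operators -/

/-- The four single-qubit Pauli labels. -/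
inductive Pauli where
  | I | X | Y | Z
  deriving DecidableEq

/-- The Pauli matrices. -/
def Pauli.matrix : Pauli → Matrix (Fin 2) (Fin 2) ℂ
  | .I => 1
  | .X => !![0, 1; 1, 0]
  | .Y => !![0, -Complex.I; Complex.I, 0]
  | .Z => !![1, 0; 0, -1]

/-- An element `phase • ⨂ i, string i` of the Pauli group on the qubits indexed by `ι`;
the phase is one of `1, -1, i, -i`. -/
structure PauliOp (ι : Type) where
  phase : ℂ
  phase_pow : phase ^ 4 = 1
  string : ι → Pauli

/-- The operator on the Hilbert space of the qubits `ι` (computational basis `ι → Fin 2`). -/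
def PauliOp.toMatrix {ι : Type} [Fintype ι] (P : PauliOp ι) :
    Matrix (ι → Fin 2) (ι → Fin 2) ℂ :=
  P.phase • Matrix.of fun x y => ∏ i, (P.string i).matrix (x i) (y i)

/-- The number of qubits on which the operator is not a multiple of the identity. -/
def PauliOp.weight {ι : Type} [Fintype ι] (P : PauliOp ι) : ℕ :=
  (Finset.univ.filter fun i => P.string i ≠ Pauli.I).card

/-- No qubit is acted on by `σ_y`. -/
def PauliOp.YFree {ι : Type} (P : PauliOp ι) : Prop :=
  ∀ i, P.string i ≠ Pauli.Y

/-- The operator `σ_w ⊗ ⋯ ⊗ σ_w`, with phase `1`. -/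
def PauliOp.const (ι : Type) (w : Pauli) : PauliOp ι :=
  ⟨1, one_pow 4, fun _ => w⟩

/-- `U` is a Clifford unitary: it conjugates Pauli operators to Pauli operators. -/
def IsClifford {ι : Type} [Fintype ι] [DecidableEq ι]
    (U : Matrix (ι → Fin 2) (ι → Fin 2) ℂ) : Prop :=
  U ∈ Matrix.unitaryGroup (ι → Fin 2) ℂ ∧
    ∀ P : PauliOp ι, ∃ Q : PauliOp ι, U * P.toMatrix * Uᴴ = Q.toMatrix

/-! ### Superoperators -/

/-- Linear maps from operators on `ℂ^n` to operators on `ℂ^m`. -/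
abbrev SuperOp (n m : Type) := Matrix n n ℂ →ₗ[ℂ] Matrix m m ℂ

/-- `ρ ↦ A ρ A†`. -/
def conjBy {n m : Type} [Fintype n] (A : Matrix m n ℂ) : SuperOp n m where
  toFun ρ := A * ρ * Aᴴ
  map_add' ρ τ := by rw [Matrix.mul_add, Matrix.add_mul]
  map_smul' c ρ := by simp

/-- The tensor power `Φ^{⊗ι}` of a single-qubit superoperator: the linear map with
`⨂ i, |x i⟩⟨y i| ↦ ⨂ i, Φ(|x i⟩⟨y i|)`. -/
def tensorPower (ι : Type) [Fintype ι] [DecidableEq ι] (Φ : SuperOp (Fin 2) (Fin 2)) :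
    SuperOp (ι → Fin 2) (ι → Fin 2) where
  toFun ρ := Matrix.of fun a c => ∑ x : ι → Fin 2, ∑ y : ι → Fin 2,
    ρ x y * ∏ i, Φ (Matrix.single (x i) (y i) 1) (a i) (c i)
  map_add' ρ τ := by
    ext a c
    simp [add_mul, Finset.sum_add_distrib]
  map_smul' r ρ := by
    ext a c
    simp [mul_assoc, Finset.mul_sum]

/-- `Φ ⊗ id_R` for a reference system `R`: `Φ` is applied to each block `⟨i|_R ρ |j⟩_R`. -/
def ampliate {n m : Type} (r : Type) (Φ : SuperOp n m) (ρ : Matrix (n × r) (n × r) ℂ) :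
    Matrix (m × r) (m × r) ℂ :=
  Matrix.of fun p q => Φ (Matrix.of fun x y => ρ (x, p.2) (y, q.2)) p.1 q.1

/-- The trace norm `‖A‖₁`: the sum of the singular values, i.e. of the square roots of the
eigenvalues of `A† A`. -/
def traceNorm {n : Type} [Fintype n] [DecidableEq n] (A : Matrix n n ℂ) : ℝ :=
  ∑ i, Real.sqrt ((Matrix.isHermitian_conjTranspose_mul_self A).eigenvalues i)

/-- Density operators. -/
def IsState {n : Type} [Fintype n] (ρ : Matrix n n ℂ) : Prop :=
  ρ.PosSemidef ∧ ρ.trace = 1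

/-- The diamond norm `max_ρ ‖(Φ ⊗ id_R)(ρ)‖₁`, over all states `ρ` of the input system and a
reference system `R` of the same dimension. -/
def diamondNorm {n m : Type} [Fintype n] [Fintype m] [DecidableEq n] [DecidableEq m]
    (Φ : SuperOp n m) : ℝ :=
  sSup {c : ℝ | ∃ ρ : Matrix (n × n) (n × n) ℂ, IsState ρ ∧ c = traceNorm (ampliate n Φ ρ)}

theorem sum_eigenvalues_conjTranspose_mul_self {n : Type} [Fintype n] [DecidableEq n]
    (A : Matrix n n ℂ) :
    ∑ i, (Matrix.isHermitian_conjTranspose_mul_self A).eigenvalues i =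
      ∑ j, ∑ k, ‖A j k‖ ^ 2 := by
  have htr := (Matrix.isHermitian_conjTranspose_mul_self A).trace_eq_sum_eigenvalues
  have h2 : (Aᴴ * A).trace = ((∑ j, ∑ k, ‖A j k‖ ^ 2 : ℝ) : ℂ) := by
    rw [Finset.sum_comm]
    simp [Matrix.trace, Matrix.mul_apply, Complex.conj_mul']
  have h3 := htr.symm.trans h2
  apply Complex.ofReal_injective
  rw [← h3]
  push_cast
  rfl

theorem traceNorm_le {n : Type} [Fintype n] [DecidableEq n] (A : Matrix n n ℂ) :
    traceNorm A ≤ ∑ _i : n, (1 + ∑ j, ∑ k, ‖A j k‖ ^ 2) := by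
  refine Finset.sum_le_sum fun i _ => ?_
  have h0 := (Matrix.posSemidef_conjTranspose_mul_self A).eigenvalues_nonneg
  have h1 := Finset.single_le_sum (fun i _ => h0 i) (Finset.mem_univ i)
  rw [sum_eigenvalues_conjTranspose_mul_self] at h1
  have h2 := Real.sq_sqrt (h0 i)
  nlinarith [sq_nonneg
    (Real.sqrt ((Matrix.isHermitian_conjTranspose_mul_self A).eigenvalues i) - 1), h0 i]

open scoped MatrixOrder Matrix.Norms.L2Operator in
theorem exists_eq_conjTranspose_mul_self {n : Type} [Fintype n] [DecidableEq n]
    {ρ : Matrix n n ℂ} (h : ρ.PosSemidef) : ∃ B : Matrix n n ℂ, ρ = Bᴴ * B :=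
  CStarAlgebra.nonneg_iff_eq_star_mul_self.mp h.nonneg

theorem IsState.norm_apply_le {n : Type} [Fintype n] {ρ : Matrix n n ℂ}
    (h : IsState ρ) (i j : n) : ‖ρ i j‖ ≤ 1 := by
  classical
  obtain ⟨B, rfl⟩ := exists_eq_conjTranspose_mul_self h.1
  have ht : ∑ k, ∑ l, ‖B l k‖ ^ 2 = 1 := by
    have h2 : (Bᴴ * B).trace = ((∑ k, ∑ l, ‖B l k‖ ^ 2 : ℝ) : ℂ) := by
      simp [Matrix.trace, Matrix.mul_apply, Complex.conj_mul']
    have h3 := h2.symm.trans h.2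
    exact_mod_cast h3
  have hc : ∀ k, ∑ l, ‖B l k‖ ^ 2 ≤ 1 := fun k => ht ▸
    Finset.single_le_sum (f := fun k => ∑ l, ‖B l k‖ ^ 2)
      (fun k _ => Finset.sum_nonneg fun l _ => sq_nonneg _) (Finset.mem_univ k)
  calc ‖(Bᴴ * B) i j‖ ≤ ∑ l, ‖B l i‖ * ‖B l j‖ := by
        rw [Matrix.mul_apply]
        refine (norm_sum_le _ _).trans (le_of_eq ?_)
        simp
    _ ≤ ∑ l, (‖B l i‖ ^ 2 + ‖B l j‖ ^ 2) / 2 :=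
        Finset.sum_le_sum fun l _ => by nlinarith [sq_nonneg (‖B l i‖ - ‖B l j‖)]
    _ ≤ 1 := by
        rw [← Finset.sum_div, Finset.sum_add_distrib]
        linarith [hc i, hc j]

/-- The supremum in the diamond norm is over a bounded set. -/
theorem diamondNorm_bddAbove {n m : Type} [Fintype n] [Fintype m] [DecidableEq n] [DecidableEq m]
    (Φ : SuperOp n m) :
    BddAbove {c : ℝ | ∃ ρ : Matrix (n × n) (n × n) ℂ,
      IsState ρ ∧ c = traceNorm (ampliate n Φ ρ)} := by
  refine ⟨∑ _i : m × n, (1 + ∑ p : m × n, ∑ q : m × n,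
    (∑ x, ∑ y, ‖Φ (Matrix.single x y 1) p.1 q.1‖) ^ 2), ?_⟩
  rintro c ⟨ρ, hρ, rfl⟩
  refine (traceNorm_le _).trans ?_
  gcongr with _ _ p _ q _
  have h : ampliate n Φ ρ p q =
      ∑ x, ∑ y, ρ (x, p.2) (y, q.2) * Φ (Matrix.single x y 1) p.1 q.1 := by
    have h2 : ∀ M : Matrix n n ℂ, Φ M p.1 q.1 =
        ∑ x, ∑ y, M x y * Φ (Matrix.single x y 1) p.1 q.1 := by
      intro M
      have h3 : ∀ x y, Matrix.single x y (M x y) = M x y • Matrix.single x y (1 : ℂ) := by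
        intro x y
        simp
      conv_lhs => rw [Matrix.matrix_eq_sum_single M]
      simp only [h3, map_sum, map_smul, Matrix.sum_apply, Matrix.smul_apply, smul_eq_mul]
    exact h2 _
  rw [h]
  refine (norm_sum_le _ _).trans (Finset.sum_le_sum fun x _ => ?_)
  refine (norm_sum_le _ _).trans (Finset.sum_le_sum fun y _ => ?_)
  rw [norm_mul]
  exact mul_le_of_le_one_left (norm_nonneg _) (hρ.norm_apply_le _ _)

/-! ### Single-qubit channels -/

/-- `N_w(ρ) = (1 - p) ρ + p σ_w ρ σ_w`. -/
def pauliFlip (w : Pauli) (p : ℝ) : SuperOp (Fin 2) (Fin 2) :=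
  ((1 - p : ℝ) : ℂ) • LinearMap.id + (p : ℂ) • conjBy w.matrix

/-- The depolarizing channel `M_ε(ρ) = (1 - ε) ρ + ε Tr(ρ) I / 2`. -/
def depolarizing (ε : ℝ) : SuperOp (Fin 2) (Fin 2) :=
  ((1 - ε : ℝ) : ℂ) • LinearMap.id +
    (ε : ℂ) • (Matrix.traceLinearMap (Fin 2) ℂ ℂ).smulRight ((1 / 2 : ℂ) • 1)

/-- The fully dephasing channel `D_w(ρ) = (ρ + σ_w ρ σ_w) / 2`. -/
def dephase (w : Pauli) : SuperOp (Fin 2) (Fin 2) :=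
  (1 / 2 : ℂ) • (LinearMap.id + conjBy w.matrix)

/-! ### The tree -/

/-- The nodes at level `t` of the full `b`-ary tree; there are `b ^ t` of them. The children of
`v` are `Fin.snoc v j` for `j : Fin b`. -/
abbrev Level (b t : ℕ) := Fin t → Fin b

/-- A choice of a unitary on `b` qubits for every node of the `b`-ary tree. -/
abbrev Unitaries (b : ℕ) := (t : ℕ) → Level b t → Matrix (Fin b → Fin 2) (Fin b → Fin 2) ℂ

/-- The encoder `V|ψ⟩ = U (|ψ⟩ ⊗ |0⟩^{⊗(b-1)})`; the data qubit is the qubit `0`. -/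
def encoder {b : ℕ} [NeZero b] (U : Matrix (Fin b → Fin 2) (Fin b → Fin 2) ℂ) :
    Matrix (Fin b → Fin 2) (Fin 2) ℂ :=
  Matrix.of fun x s => U x (Function.update (fun _ => 0) 0 s)

/-- The layer `⨂_v V_v`, over the nodes `v` at level `t`, where `V_v` is the encoder at `v`; it
maps the qubits at level `t` to those at level `t + 1`. -/
def layer {b : ℕ} [NeZero b] (U : Unitaries b) (t : ℕ) :
    Matrix (Level b (t + 1) → Fin 2) (Level b t → Fin 2) ℂ :=
  Matrix.of fun x y => ∏ v : Level b t,
    encoder (U t v) (fun j => x (Fin.snoc (α := fun _ => Fin b) v j)) (y v)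

/-- The identification of `ℂ²` with the space of the single qubit at the root. -/
def rootIso (b : ℕ) : Matrix (Level b 0 → Fin 2) (Fin 2) ℂ :=
  Matrix.of fun x s => if x Fin.elim0 = s then 1 else 0

/-- The noiseless concatenated encoder `V_T`, with one encoder per node. -/
def concatEncoder {b : ℕ} [NeZero b] (U : Unitaries b) :
    (T : ℕ) → Matrix (Level b T → Fin 2) (Fin 2) ℂ
  | 0 => rootIso b
  | T + 1 => layer U T * concatEncoder U T

/-- The noisy tree channel `E_T`: each layer of encoders is followed by the noise `N` on each of
its output qubits. -/
def treeChannel {b : ℕ} [NeZero b] (U : Unitaries b) (N : SuperOp (Fin 2) (Fin 2)) :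
    (T : ℕ) → SuperOp (Fin 2) (Level b T → Fin 2)
  | 0 => conjBy (rootIso b)
  | T + 1 => tensorPower (Level b (T + 1)) N ∘ₗ conjBy (layer U T) ∘ₗ treeChannel U N T

/-- `L` is a logical `σ_w` operator of the concatenated encoder: `L V_T = V_T σ_w`. -/
def IsLogical {b : ℕ} [NeZero b] (U : Unitaries b) (T : ℕ) (w : Pauli)
    (L : PauliOp (Level b T)) : Prop :=
  L.toMatrix * concatEncoder U T = concatEncoder U T * w.matrix

/-- `L` is the last term of a chain `L_w[0] = σ_w → L_w[1] → ⋯ → L_w[T] = L` of `σ_y`-free Pauli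
operators, `L_w[t]` acting on the qubits at level `t`, such that each layer of encoders maps
`L_w[t]` to `L_w[t+1]`. -/
def HasYFreeChain {b : ℕ} [NeZero b] (U : Unitaries b) (T : ℕ) (w : Pauli)
    (L : PauliOp (Level b T)) : Prop :=
  ∃ C : (t : ℕ) → PauliOp (Level b t),
    C 0 = PauliOp.const (Level b 0) w ∧ C T = L ∧
    (∀ t ≤ T, (C t).YFree) ∧
    ∀ t < T, (C (t + 1)).toMatrix * layer U t = layer U t * (C t).toMatrix

end QTree

end

open QTree

/-
A logical Pauli operator can be pushed down the tree layer by layer: at every node the encoder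
turns the letter at that node into a string of letters at its children. If the noise is a flip
along each of these letters preceded by another Pauli channel, then the second channel commutes
with the letters, so the random power of `σ_w` which distinguishes `E_T` from `E_T ∘ D_w` is a bit
broadcast down the tree, flipped with probability `q` on every edge, followed by a channel which
depends only on the bits at the leaves. The diamond distance is therefore at most the total
variation distance between the two distributions of these bits. Its square is bounded by their
`χ²`-information about the root, which is subadditive over the branches at a node and contracts by
`(1 - 2 q)²` along an edge. Every leaf thus contributes at most `(1 - 2 q) ^ (2 T)`, and a leaf with
letter `I` contributes nothing.
-/

noncomputable section

namespace QTree

/-! ### Trace norm -/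

section TraceNorm

variable {n : Type} [Fintype n] [DecidableEq n]

theorem traceNorm_eq_sum_abs_eigenvalues {A : Matrix n n ℂ} (hA : A.IsHermitian) :
    traceNorm A = ∑ i, |hA.eigenvalues i| := by
  set H := Matrix.isHermitian_conjTranspose_mul_self A
  have hsq : Aᴴ * A = cfc (fun x : ℝ => x ^ 2) A := by
    rw [cfc_pow_id A 2 hA.isSelfAdjoint, hA.eq, pow_two]
  have hroots : Finset.univ.val.map (fun i => (H.eigenvalues i : ℂ)) =
      Finset.univ.val.map (fun i => ((hA.eigenvalues i ^ 2 : ℝ) : ℂ)) := by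
    refine H.roots_charpoly_eq_eigenvalues.symm.trans ?_
    rw [hsq, hA.charpoly_cfc_eq, Polynomial.roots_prod]
    · simp [-Complex.ofReal_pow]
    · simp [-Complex.ofReal_pow, Finset.prod_ne_zero_iff, Polynomial.X_sub_C_ne_zero]
  have hsum := congrArg (fun s => (s.map fun z : ℂ => √z.re).sum) hroots
  simpa [traceNorm, Real.sqrt_sq_eq_abs, -Complex.ofReal_pow] using hsum

theorem traceNorm_sum_smul_le {κ : Type*} [Fintype κ] (c : κ → ℝ) {S : κ → Matrix n n ℂ}
    (hS : ∀ k, (S k).PosSemidef) :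
    traceNorm (∑ k, (c k : ℂ) • S k) ≤ ∑ k, |c k| * (S k).trace.re := by
  set A := ∑ k, (c k : ℂ) • S k with hA_def
  have hA : A.IsHermitian := by
    simp only [Matrix.IsHermitian, hA_def, Matrix.conjTranspose_sum, Matrix.conjTranspose_smul,
      (hS _).isHermitian.eq, Complex.star_def, Complex.conj_ofReal]
  set V : Matrix n n ℂ := (hA.eigenvectorUnitary : Matrix n n ℂ)
  have hV : V * Vᴴ = 1 := Unitary.coe_mul_star_self hA.eigenvectorUnitary
  have hdiag : Vᴴ * A * V = Matrix.diagonal fun i => (hA.eigenvalues i : ℂ) := by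
    have := hA.conjStarAlgAut_star_eigenvectorUnitary
    rwa [Unitary.conjStarAlgAut_star_apply] at this
  have heigenvalue (i : n) : hA.eigenvalues i = ∑ k, c k * ((Vᴴ * S k * V) i i).re := by
    have := congrArg (fun M => (M i i).re) hdiag
    simpa [hA_def, Matrix.mul_sum, Matrix.sum_mul, Matrix.sum_apply] using this.symm
  have hnonneg (k : κ) (i : n) : 0 ≤ ((Vᴴ * S k * V) i i).re :=
    (Complex.le_def.1 ((hS k).conjTranspose_mul_mul_same V).diag_nonneg).1
  calc traceNorm A = ∑ i, |∑ k, c k * ((Vᴴ * S k * V) i i).re| := by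
        rw [traceNorm_eq_sum_abs_eigenvalues hA]
        simp only [heigenvalue]
    _ ≤ ∑ i, ∑ k, |c k| * ((Vᴴ * S k * V) i i).re := by
        refine Finset.sum_le_sum fun i _ => (Finset.abs_sum_le_sum_abs _ _).trans_eq ?_
        simp only [abs_mul, abs_of_nonneg (hnonneg _ i)]
    _ = ∑ k, |c k| * (Vᴴ * S k * V).trace.re := by
        rw [Finset.sum_comm]
        simp only [← Finset.mul_sum, Matrix.trace, Matrix.diag, Complex.re_sum]
    _ = ∑ k, |c k| * (S k).trace.re := by
        simp only [Matrix.trace_mul_cycle _ _ V, hV, Matrix.one_mul]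

end TraceNorm

/-! ### Channels -/

section ConjBy

variable {n m l : Type} [Fintype n]

theorem conjBy_apply (A : Matrix m n ℂ) (ρ : Matrix n n ℂ) : conjBy A ρ = A * ρ * Aᴴ := rfl

theorem conjBy_comp [Fintype m] (A : Matrix l m ℂ) (B : Matrix m n ℂ) :
    conjBy A ∘ₗ conjBy B = conjBy (A * B) := by
  ext1 ρ
  simp only [LinearMap.comp_apply, conjBy_apply, Matrix.conjTranspose_mul, Matrix.mul_assoc]

theorem conjBy_one [DecidableEq n] : conjBy (1 : Matrix n n ℂ) = LinearMap.id := by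
  ext1 ρ
  simp [conjBy_apply]

theorem conjBy_smul {c : ℂ} (hc : ‖c‖ = 1) (A : Matrix m n ℂ) : conjBy (c • A) = conjBy A := by
  ext1 ρ
  have hc' : star c * c = 1 := by simp [Complex.conj_mul', hc]
  simp only [conjBy_apply, Matrix.conjTranspose_smul, Matrix.smul_mul, Matrix.mul_smul, smul_smul,
    hc', one_smul]

end ConjBy

theorem ampliate_sum_smul {n m : Type} {κ : Type*} [Fintype κ] (r : Type) (c : κ → ℂ)
    (Φ : κ → SuperOp n m) (ρ : Matrix (n × r) (n × r) ℂ) :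
    ampliate r (∑ k, c k • Φ k) ρ = ∑ k, c k • ampliate r (Φ k) ρ := by
  ext p q
  simp [ampliate, Matrix.sum_apply]

/-- Quantum channels, that is, completely positive trace-preserving maps. Complete positivity is
positivity after adding a reference system of any finite size. -/
structure IsChannel {n m : Type} [Fintype n] [Fintype m] (Φ : SuperOp n m) : Prop where
  posSemidef_ampliate (r : Type) [Fintype r] {ρ : Matrix (n × r) (n × r) ℂ} :
    ρ.PosSemidef → (ampliate r Φ ρ).PosSemidef
  trace_apply (ρ : Matrix n n ℂ) : (Φ ρ).trace = ρ.trace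

/-- Isometries, that is, operators `A` with `A† A = 1`. -/
def IsIsometry {n m : Type*} [Fintype m] [DecidableEq n] (A : Matrix m n ℂ) : Prop :=
  Aᴴ * A = 1

section Channel

variable {n m l : Type} [Fintype n] [Fintype m] [Fintype l]

theorem IsChannel.comp {Φ : SuperOp m l} {Ψ : SuperOp n m} (hΦ : IsChannel Φ)
    (hΨ : IsChannel Ψ) : IsChannel (Φ ∘ₗ Ψ) where
  posSemidef_ampliate r _ _ hρ := hΦ.posSemidef_ampliate r (hΨ.posSemidef_ampliate r hρ)
  trace_apply ρ := (hΦ.trace_apply _).trans (hΨ.trace_apply ρ)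

theorem IsChannel.trace_ampliate {Φ : SuperOp n m} (hΦ : IsChannel Φ) (r : Type) [Fintype r]
    (ρ : Matrix (n × r) (n × r) ℂ) : (ampliate r Φ ρ).trace = ρ.trace := by
  simp only [Matrix.trace, Matrix.diag, Fintype.sum_prod_type_right]
  exact Finset.sum_congr rfl fun j _ => hΦ.trace_apply (.of fun x y => ρ (x, j) (y, j))

open scoped Kronecker in
theorem isChannel_conjBy [DecidableEq n] {A : Matrix m n ℂ} (hA : IsIsometry A) :
    IsChannel (conjBy A) where
  posSemidef_ampliate r _ ρ hρ := by
    classical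
    have hkronecker : ampliate r (conjBy A) ρ = (A ⊗ₖ (1 : Matrix r r ℂ)) * ρ *
        (A ⊗ₖ (1 : Matrix r r ℂ))ᴴ := by
      ext ⟨a, i⟩ ⟨c, j⟩
      simp [ampliate, conjBy_apply, Matrix.mul_apply, Matrix.kroneckerMap_apply,
        Fintype.sum_prod_type, Matrix.one_apply, apply_ite]
    exact hkronecker ▸ hρ.mul_mul_conjTranspose_same _
  trace_apply ρ := by
    rw [conjBy_apply, Matrix.trace_mul_cycle, show Aᴴ * A = 1 from hA, Matrix.one_mul]

theorem IsChannel.sum_smul {κ : Type*} [Fintype κ] {c : κ → ℝ} (hc : c ∈ stdSimplex ℝ κ)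
    {Φ : κ → SuperOp n m} (hΦ : ∀ k, IsChannel (Φ k)) : IsChannel (∑ k, (c k : ℂ) • Φ k) where
  posSemidef_ampliate r _ ρ hρ := by
    rw [ampliate_sum_smul]
    exact Matrix.posSemidef_sum _ fun k _ =>
      ((hΦ k).posSemidef_ampliate r hρ).smul (by exact_mod_cast hc.1 k)
  trace_apply ρ := by
    have hsum : ∑ k, (c k : ℂ) = 1 := by exact_mod_cast hc.2
    simp [Matrix.trace_sum, (hΦ _).trace_apply, ← Finset.sum_mul, hsum]

variable [DecidableEq n] [DecidableEq m]

theorem diamondNorm_nonneg (Φ : SuperOp n m) : 0 ≤ diamondNorm Φ := by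
  refine Real.sSup_nonneg ?_
  rintro _ ⟨ρ, -, rfl⟩
  exact Finset.sum_nonneg fun i _ => Real.sqrt_nonneg _

theorem diamondNorm_sum_smul_le {κ : Type*} [Fintype κ] (c : κ → ℝ) {Φ : κ → SuperOp n m}
    (hΦ : ∀ k, IsChannel (Φ k)) : diamondNorm (∑ k, (c k : ℂ) • Φ k) ≤ ∑ k, |c k| := by
  refine Real.sSup_le ?_ (Finset.sum_nonneg fun _ _ => abs_nonneg _)
  rintro _ ⟨ρ, hρ, rfl⟩
  rw [ampliate_sum_smul]
  refine (traceNorm_sum_smul_le c fun k => (hΦ k).posSemidef_ampliate n hρ.1).trans_eq ?_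
  simp only [(hΦ _).trace_ampliate, hρ.2, Complex.one_re, mul_one]

end Channel

/-! ### Information carried by binary-input kernels -/

section Distributions

variable {Ω κ : Type*} [Fintype Ω] [Fintype κ]

theorem sum_mul_mem_stdSimplex {p : κ → ℝ} (hp : p ∈ stdSimplex ℝ κ) {f : κ → Ω → ℝ}
    (hf : ∀ y, f y ∈ stdSimplex ℝ Ω) : (fun ω => ∑ y, p y * f y ω) ∈ stdSimplex ℝ Ω := by
  convert (convex_stdSimplex ℝ Ω).sum_mem (fun y _ => hp.1 y) hp.2 fun y _ => hf y using 1
  ext ω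
  simp [Finset.sum_apply]

theorem prod_mem_stdSimplex [DecidableEq κ] {p : κ → Ω → ℝ} (hp : ∀ i, p i ∈ stdSimplex ℝ Ω) :
    (fun ω : κ → Ω => ∏ i, p i (ω i)) ∈ stdSimplex ℝ (κ → Ω) := by
  refine ⟨fun ω => Finset.prod_nonneg fun i _ => (hp i).1 _, ?_⟩
  simp [← Fintype.prod_sum, (hp _).2]

end Distributions

/-- The `χ²`-information `∑ ω, d ω ^ 2 / m ω` that the output of the kernel `k` carries about a
uniform input bit, where `m` is the output distribution and `d` is half the difference of the two
conditional distributions. It plays the role of the mutual information. -/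
def chiSq {Ω : Type*} [Fintype Ω] (k : Bool → Ω → ℝ) : ℝ :=
  ∑ ω, ((k false ω - k true ω) / 2) ^ 2 / ((k false ω + k true ω) / 2)

section ChiSq

variable {Ω Ω' : Type*} [Fintype Ω] [Fintype Ω'] {k : Bool → Ω → ℝ}

theorem chiSq_comp_equiv (e : Ω' ≃ Ω) (k : Bool → Ω → ℝ) :
    chiSq (fun x ω => k x (e ω)) = chiSq k :=
  e.sum_comp fun ω => ((k false ω - k true ω) / 2) ^ 2 / ((k false ω + k true ω) / 2)

theorem abs_half_sub_le_half_add (hk : ∀ x, k x ∈ stdSimplex ℝ Ω) (ω : Ω) :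
    |(k false ω - k true ω) / 2| ≤ (k false ω + k true ω) / 2 := by
  have h0 := (hk false).1 ω
  have h1 := (hk true).1 ω
  rw [abs_le]
  constructor <;> linarith

theorem sum_half_add_eq_one (hk : ∀ x, k x ∈ stdSimplex ℝ Ω) :
    ∑ ω, (k false ω + k true ω) / 2 = 1 := by
  rw [← Finset.sum_div, Finset.sum_add_distrib, (hk _).2, (hk _).2, add_self_div_two]

theorem sum_half_sub_eq_zero (hk : ∀ x, k x ∈ stdSimplex ℝ Ω) :
    ∑ ω, (k false ω - k true ω) / 2 = 0 := by
  rw [← Finset.sum_div, Finset.sum_sub_distrib, (hk _).2, (hk _).2, sub_self, zero_div]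

theorem sq_sum_abs_half_sub_le_chiSq (hk : ∀ x, k x ∈ stdSimplex ℝ Ω) :
    (∑ ω, |(k false ω - k true ω) / 2|) ^ 2 ≤ chiSq k := by
  have hle := abs_half_sub_le_half_add hk
  have hnonneg (ω : Ω) := (abs_nonneg _).trans (hle ω)
  rw [chiSq, ← mul_one (∑ ω, _ / _), ← sum_half_add_eq_one hk]
  refine Finset.sum_sq_le_sum_mul_sum_of_sq_le_mul _
    (fun ω _ => div_nonneg (sq_nonneg _) (hnonneg ω)) (fun ω _ => hnonneg ω) fun ω _ => ?_
  rw [sq_abs, div_mul_cancel_of_imp]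
  exact fun h => by rw [abs_nonpos_iff.1 ((hle ω).trans_eq h), zero_pow two_ne_zero]

/- With `x = d / m` and `y = e / n` this says `(x + y)² / (1 + xy) ≤ (x + y)² - xy (x² + y²)`,
a consequence of `1 / (1 + xy) ≥ 1 - xy`. The terms other than the first two are odd in both `d`
and `e`. -/
theorem sq_div_add_le {m n d e : ℝ} (hd : |d| ≤ m) (he : |e| ≤ n) :
    (m * e + d * n) ^ 2 / (m * n + d * e) ≤
      m * (e ^ 2 / n) + d ^ 2 / m * n +
        (2 * (d * e) - d ^ 3 / m ^ 2 * e - d * (e ^ 3 / n ^ 2)) := by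
  rcases ((abs_nonneg d).trans hd).eq_or_lt with rfl | hm
  · simp [abs_nonpos_iff.1 hd]
  rcases ((abs_nonneg e).trans he).eq_or_lt with rfl | hn
  · simp [abs_nonpos_iff.1 he]
  obtain ⟨x, rfl⟩ : ∃ x, d = m * x := ⟨d / m, by field_simp⟩
  obtain ⟨y, rfl⟩ : ∃ y, e = n * y := ⟨e / n, by field_simp⟩
  have hx : |x| ≤ 1 := by simpa [abs_mul, abs_of_pos hm, hm] using hd
  have hy : |y| ≤ 1 := by simpa [abs_mul, abs_of_pos hn, hn] using he
  have hxy : |x * y| ≤ 1 := by rw [abs_mul]; exact mul_le_one₀ hx (abs_nonneg y) hy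
  have hx2 : x ^ 2 ≤ 1 := (sq_le_one_iff_abs_le_one x).2 hx
  have hy2 : y ^ 2 ≤ 1 := (sq_le_one_iff_abs_le_one y).2 hy
  have hscalar : (x + y) ^ 2 / (1 + x * y) ≤ (x + y) ^ 2 - x * y * (x ^ 2 + y ^ 2) := by
    refine div_le_of_le_mul₀ (by linarith [(abs_le.1 hxy).1]) ?_ ?_
    · nlinarith [abs_le.1 hxy, sq_nonneg (x + y), sq_nonneg (x - y)]
    · nlinarith [mul_nonneg (sq_nonneg (x * y)) (by linarith : 0 ≤ 2 - x ^ 2 - y ^ 2)]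
  have hmn : (m * (n * y) + m * x * n) ^ 2 / (m * n + m * x * (n * y)) =
      m * n * ((x + y) ^ 2 / (1 + x * y)) := by
    rw [show m * n + m * x * (n * y) = m * n * (1 + x * y) by ring, ← mul_div_assoc,
      ← mul_div_mul_left _ (1 + x * y) (mul_pos hm hn).ne']
    ring
  rw [hmn]
  refine (mul_le_mul_of_nonneg_left hscalar (mul_pos hm hn).le).trans_eq ?_
  field_simp
  ring

theorem chiSq_prod_le {l : Bool → Ω' → ℝ} (hk : ∀ x, k x ∈ stdSimplex ℝ Ω)
    (hl : ∀ x, l x ∈ stdSimplex ℝ Ω') :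
    chiSq (fun x (ω : Ω × Ω') => k x ω.1 * l x ω.2) ≤ chiSq k + chiSq l := by
  set m := fun ω => (k false ω + k true ω) / 2 with hm
  set d := fun ω => (k false ω - k true ω) / 2 with hd
  set n := fun ω => (l false ω + l true ω) / 2 with hn
  set e := fun ω => (l false ω - l true ω) / 2 with he
  have hsum_m : ∑ ω, m ω = 1 := sum_half_add_eq_one hk
  have hsum_n : ∑ ω, n ω = 1 := sum_half_add_eq_one hl
  have hsum_d : ∑ ω, d ω = 0 := sum_half_sub_eq_zero hk
  have hsum_e : ∑ ω, e ω = 0 := sum_half_sub_eq_zero hl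
  calc chiSq (fun x (ω : Ω × Ω') => k x ω.1 * l x ω.2)
      = ∑ i, ∑ j, (m i * e j + d i * n j) ^ 2 / (m i * n j + d i * e j) := by
        rw [chiSq, Fintype.sum_prod_type]
        refine Finset.sum_congr rfl fun i _ => Finset.sum_congr rfl fun j _ => ?_
        congr 1 <;> simp only [hm, hd, hn, he] <;> ring
    _ ≤ ∑ i, ∑ j, (m i * (e j ^ 2 / n j) + d i ^ 2 / m i * n j +
          (2 * (d i * e j) - d i ^ 3 / m i ^ 2 * e j - d i * (e j ^ 3 / n j ^ 2))) := by
        gcongr with i _ j _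
        exact sq_div_add_le (abs_half_sub_le_half_add hk i) (abs_half_sub_le_half_add hl j)
    _ = chiSq k + chiSq l := by
        simp only [Finset.sum_add_distrib, Finset.sum_sub_distrib, ← Finset.mul_sum,
          ← Finset.sum_mul, hsum_m, hsum_n, hsum_d, hsum_e]
        simp only [chiSq, mul_zero, zero_mul, sub_zero, add_zero, one_mul, mul_one]
        exact add_comm _ _

theorem chiSq_pi_le {n : ℕ} {k : Fin n → Bool → Ω → ℝ} (hk : ∀ i x, k i x ∈ stdSimplex ℝ Ω) :
    chiSq (fun x (ω : Fin n → Ω) => ∏ i, k i x (ω i)) ≤ ∑ i, chiSq (k i) := by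
  induction n with
  | zero => simp [chiSq]
  | succ n ih =>
    rw [Fin.sum_univ_succ, ← chiSq_comp_equiv (Fin.consEquiv fun _ => Ω)]
    simp only [Fin.consEquiv_apply, Fin.prod_univ_succ, Fin.cons_zero, Fin.cons_succ]
    have htail (x : Bool) := prod_mem_stdSimplex fun i : Fin n => hk i.succ x
    exact (chiSq_prod_le (hk 0) htail).trans (by gcongr; exact ih fun i => hk i.succ)

end ChiSq

/-- The transition probabilities of the binary symmetric channel with flip probability `q`. -/
def bsc (q : ℝ) (x y : Bool) : ℝ :=
  if y = x then 1 - q else q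

theorem bsc_mem_stdSimplex {q : ℝ} (hq : q ∈ Set.Icc (0 : ℝ) 1) (x : Bool) :
    bsc q x ∈ stdSimplex ℝ Bool := by
  refine ⟨fun y => ?_, by cases x <;> simp [bsc]⟩
  unfold bsc
  split_ifs
  exacts [sub_nonneg.2 hq.2, hq.1]

theorem chiSq_bsc (q : ℝ) : chiSq (bsc q) = (1 - 2 * q) ^ 2 := by
  simp only [chiSq, bsc, Fintype.sum_bool, Bool.false_eq_true, Bool.true_eq_false, if_true,
    if_false]
  ring

theorem chiSq_bsc_comp {Ω : Type*} [Fintype Ω] (q : ℝ) (k : Bool → Ω → ℝ) :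
    chiSq (fun x ω => ∑ y, bsc q x y * k y ω) = (1 - 2 * q) ^ 2 * chiSq k := by
  simp only [chiSq, Finset.mul_sum]
  refine Finset.sum_congr rfl fun ω _ => ?_
  rw [← mul_div_assoc, ← mul_pow]
  congr 2 <;> simp [bsc] <;> ring

/-! ### Broadcasting on a tree -/

/-- Functions on the nodes at level `t + 1` are functions on pairs of a node at level `t` and the
index of a child. -/
def childrenEquiv (b t : ℕ) (α : Type*) : (Level b (t + 1) → α) ≃ (Level b t → Fin b → α) where
  toFun x v j := x (Fin.snoc v j)
  invFun y u := y (Fin.init u) (u (Fin.last t))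
  left_inv x := funext fun u => congrArg x (Fin.snoc_init_self u)
  right_inv y := by
    funext v j
    simp only [Fin.init_snoc, Fin.snoc_last]

section Level

variable {b t : ℕ}

theorem childrenEquiv_apply {α : Type*} (x : Level b (t + 1) → α) (v : Level b t) (j : Fin b) :
    childrenEquiv b t α x v j = x (Fin.snoc v j) := rfl

theorem prod_level_succ {M : Type*} [CommMonoid M] (f : Level b (t + 1) → M) :
    ∏ u, f u = ∏ v : Level b t, ∏ j, f (Fin.snoc v j) := by
  rw [← Fintype.prod_prod_type']
  exact (Fintype.prod_equiv ((Equiv.prodComm _ _).trans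
    (Fin.snocEquiv fun _ : Fin (t + 1) => Fin b)) _ _ fun _ => rfl).symm

theorem sum_level_succ {M : Type*} [AddCommMonoid M] (f : Level b (t + 1) → M) :
    ∑ u, f u = ∑ v : Level b t, ∑ j, f (Fin.snoc v j) :=
  prod_level_succ (M := Multiplicative M) f

end Level

/-- The distribution of the bits at level `T` when the bit `x` at the root is passed down the tree
and flipped with probability `q t u` on the edge from level `t` to its child `u`. -/
def broadcast {b : ℕ} (q : (t : ℕ) → Level b (t + 1) → ℝ) :
    (T : ℕ) → Bool → (Level b T → Bool) → ℝ
  | 0, x, y => if (fun _ => x) = y then 1 else 0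
  | T + 1, x, y => ∑ z, broadcast q T x z * ∏ u, bsc (q T u) (z (Fin.init u)) (y u)

/-- The factor `∏ (1 - 2 q)²`, over the edges on the path from the root to `u`, by which
broadcasting along that path reduces the `χ²`-information. -/
def pathGain {b : ℕ} (q : (t : ℕ) → Level b (t + 1) → ℝ) : (T : ℕ) → Level b T → ℝ
  | 0, _ => 1
  | T + 1, u => pathGain q T (Fin.init u) * (1 - 2 * q T u) ^ 2

section Broadcast

variable {b : ℕ} {q : (t : ℕ) → Level b (t + 1) → ℝ} {T : ℕ}

theorem broadcast_mem_stdSimplex (hq : ∀ t < T, ∀ u, q t u ∈ Set.Icc (0 : ℝ) 1) (x : Bool) :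
    broadcast q T x ∈ stdSimplex ℝ (Level b T → Bool) := by
  induction T with
  | zero =>
    convert ite_eq_mem_stdSimplex ℝ (fun _ : Level b 0 => x) using 1
    ext y
    simp [broadcast, apply_ite]
  | succ T ih =>
    exact sum_mul_mem_stdSimplex (ih fun t ht => hq t (ht.trans T.lt_succ_self)) fun z =>
      prod_mem_stdSimplex fun u => bsc_mem_stdSimplex (hq T T.lt_succ_self u) _

theorem pathGain_nonneg (u : Level b T) : 0 ≤ pathGain q T u := by
  induction T with
  | zero => exact zero_le_one
  | succ T ih => exact mul_nonneg (ih _) (sq_nonneg _)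

theorem pathGain_le_pow {r : ℝ} (hq : ∀ t < T, ∀ u, (1 - 2 * q t u) ^ 2 ≤ r) (u : Level b T) :
    pathGain q T u ≤ r ^ T := by
  induction T with
  | zero => exact le_rfl
  | succ T ih =>
    have hr : 0 ≤ r := (sq_nonneg _).trans (hq T T.lt_succ_self u)
    rw [pathGain, pow_succ]
    exact mul_le_mul (ih (fun t ht => hq t (ht.trans T.lt_succ_self)) _) (hq T T.lt_succ_self u)
      (sq_nonneg _) (pow_nonneg hr T)

theorem sum_broadcast_succ_mul_prod {Ω : Type*} (k : Level b (T + 1) → Bool → Ω → ℝ) (x : Bool)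
    (ω : Level b (T + 1) → Ω) :
    ∑ y, broadcast q (T + 1) x y * ∏ u, k u (y u) (ω u) = ∑ z, broadcast q T x z *
      ∏ v : Level b T, ∏ j : Fin b, ∑ y, bsc (q T (Fin.snoc v j)) (z v) y *
        k (Fin.snoc v j) y (ω (Fin.snoc v j)) := by
  simp only [broadcast, Finset.sum_mul, mul_assoc, ← Finset.prod_mul_distrib]
  rw [Finset.sum_comm]
  simp only [← Finset.mul_sum]
  refine Finset.sum_congr rfl fun z _ => ?_
  rw [← Fintype.prod_sum fun u y => bsc (q T u) (z (Fin.init u)) y * k u y (ω u), prod_level_succ]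
  simp only [Fin.init_snoc]

/- The subtrees below the nodes at level `T` are independent observations of the bits at that
level, and the branches of a subtree are independent observations of the bit at its root. -/
theorem chiSq_broadcast_le {Ω : Type*} [Fintype Ω] {k : Level b T → Bool → Ω → ℝ}
    (hq : ∀ t < T, ∀ u, q t u ∈ Set.Icc (0 : ℝ) 1) (hk : ∀ u x, k u x ∈ stdSimplex ℝ Ω) :
    chiSq (fun x (ω : Level b T → Ω) => ∑ y, broadcast q T x y * ∏ u, k u (y u) (ω u)) ≤
      ∑ u, pathGain q T u * chiSq (k u) := by
  induction T generalizing Ω with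
  | zero =>
    simp only [broadcast, ite_mul, one_mul, zero_mul, Finset.sum_ite_eq, Finset.mem_univ, if_true,
      Fintype.prod_unique, pathGain, Fintype.sum_unique]
    exact (chiSq_comp_equiv (Equiv.funUnique (Level b 0) Ω) (k default)).le
  | succ T ih =>
    let branch (v : Level b T) (j : Fin b) (x : Bool) (ω : Ω) : ℝ :=
      ∑ y, bsc (q T (Fin.snoc v j)) x y * k (Fin.snoc v j) y ω
    have hbranch (v : Level b T) (j : Fin b) (x : Bool) : branch v j x ∈ stdSimplex ℝ Ω :=
      sum_mul_mem_stdSimplex (bsc_mem_stdSimplex (hq T T.lt_succ_self _) x) (hk _)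
    let subtree (v : Level b T) (x : Bool) (ω : Fin b → Ω) : ℝ := ∏ j, branch v j x (ω j)
    have hsubtree (v : Level b T) (x : Bool) : subtree v x ∈ stdSimplex ℝ (Fin b → Ω) :=
      prod_mem_stdSimplex fun j => hbranch v j x
    calc chiSq (fun x (ω : Level b (T + 1) → Ω) =>
          ∑ y, broadcast q (T + 1) x y * ∏ u, k u (y u) (ω u))
        = chiSq (fun x (ω : Level b T → Fin b → Ω) =>
            ∑ z, broadcast q T x z * ∏ v, subtree v (z v) (ω v)) := by
          rw [← chiSq_comp_equiv (childrenEquiv b T Ω)]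
          simp only [sum_broadcast_succ_mul_prod]
          rfl
      _ ≤ ∑ v : Level b T, pathGain q T v * chiSq (subtree v) :=
          ih (fun t ht => hq t (ht.trans T.lt_succ_self)) hsubtree
      _ ≤ ∑ v : Level b T, pathGain q T v * ∑ j, chiSq (branch v j) := by
          gcongr with v
          · exact pathGain_nonneg v
          · exact chiSq_pi_le (hbranch v)
      _ = ∑ u, pathGain q (T + 1) u * chiSq (k u) := by
          simp only [branch, chiSq_bsc_comp, sum_level_succ, pathGain, Fin.init_snoc,
            Finset.mul_sum, mul_assoc]

theorem sq_sum_abs_half_sub_broadcast_le (hq : ∀ t < T, ∀ u, q t u ∈ Set.Icc (0 : ℝ) 1) :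
    (∑ y, |(broadcast q T false y - broadcast q T true y) / 2|) ^ 2 ≤ ∑ u, pathGain q T u := by
  refine (sq_sum_abs_half_sub_le_chiSq (broadcast_mem_stdSimplex hq)).trans ?_
  have h := chiSq_broadcast_le hq fun (_ : Level b T) =>
    bsc_mem_stdSimplex (Set.left_mem_Icc.2 zero_le_one)
  simpa [chiSq_bsc, bsc, Finset.prod_ite_zero, ← funext_iff] using h

end Broadcast

/-! ### Tensor products of matrices and of superoperators -/

/-- The tensor product `⨂ i, A i` of a family of matrices, in the product basis. -/
def piKronecker {ι m n R : Type*} [Fintype ι] [CommMonoid R] (A : ι → Matrix m n R) :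
    Matrix (ι → m) (ι → n) R :=
  Matrix.of fun x y => ∏ i, A i (x i) (y i)

section PiKronecker

variable {ι m n l R : Type*} [Fintype ι] [CommSemiring R]

theorem piKronecker_apply (A : ι → Matrix m n R) (x : ι → m) (y : ι → n) :
    piKronecker A x y = ∏ i, A i (x i) (y i) := rfl

theorem piKronecker_mul [DecidableEq ι] [Fintype n] (A : ι → Matrix m n R)
    (B : ι → Matrix n l R) : piKronecker A * piKronecker B = piKronecker fun i => A i * B i := by
  ext x y
  simp only [Matrix.mul_apply, piKronecker_apply, ← Finset.prod_mul_distrib,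
    Finset.prod_univ_sum, Fintype.piFinset_univ]

theorem piKronecker_conjTranspose [StarRing R] (A : ι → Matrix m n R) :
    (piKronecker A)ᴴ = piKronecker fun i => (A i)ᴴ := by
  ext x y
  simp [piKronecker_apply, Matrix.conjTranspose_apply]

theorem piKronecker_one [DecidableEq m] :
    piKronecker (fun _ : ι => (1 : Matrix m m R)) = 1 := by
  ext x y
  simp [piKronecker_apply, Matrix.one_apply, Fintype.prod_ite_zero, funext_iff]

theorem piKronecker_smul (c : ι → R) (A : ι → Matrix m n R) :
    piKronecker (fun i => c i • A i) = (∏ i, c i) • piKronecker A := by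
  ext x y
  simp [piKronecker_apply, Finset.prod_mul_distrib]

theorem piKronecker_sum [DecidableEq ι] {κ : Type*} [Fintype κ] (A : ι → κ → Matrix m n R) :
    piKronecker (fun i => ∑ k, A i k) = ∑ f : ι → κ, piKronecker fun i => A i (f i) := by
  ext x y
  simp only [piKronecker_apply, Matrix.sum_apply, Finset.prod_univ_sum, Fintype.piFinset_univ]

theorem piKronecker_single [DecidableEq m] [DecidableEq n] (x : ι → m) (y : ι → n) :
    piKronecker (fun i => Matrix.single (x i) (y i) (1 : R)) = Matrix.single x y 1 := by
  ext a c
  simp [piKronecker_apply, Matrix.single_apply, Fintype.prod_ite_zero, funext_iff, forall_and]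

theorem piKronecker_apply_update [DecidableEq ι] (A : ι → Matrix m n R) (x : ι → m) (y : ι → n)
    (i : ι) (a : m) (b : n) :
    piKronecker A (Function.update x i a) (Function.update y i b) =
      A i a b * ∏ j ∈ Finset.univ.erase i, A j (x j) (y j) := by
  rw [piKronecker_apply, ← Finset.mul_prod_erase _ _ (Finset.mem_univ i)]
  simp only [Function.update_self]
  congr 1
  refine Finset.prod_congr rfl fun j hj => ?_
  simp only [Function.update_of_ne (Finset.ne_of_mem_erase hj)]

theorem exists_eq_smul_of_piKronecker_eq_smul {K : Type*} [Field K]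
    {A B : ι → Matrix m n K} {c : K} (hc : c ≠ 0) (hB : ∀ i, B i ≠ 0)
    (h : piKronecker A = c • piKronecker B) (i : ι) : ∃ d : K, A i = d • B i := by
  classical
  have hentry (j : ι) : ∃ p : m × n, B j p.1 p.2 ≠ 0 := by
    by_contra! hzero
    exact hB j (Matrix.ext fun a b => hzero (a, b))
  choose p hp using hentry
  set α := ∏ j ∈ Finset.univ.erase i, A j (p j).1 (p j).2
  set β := ∏ j ∈ Finset.univ.erase i, B j (p j).1 (p j).2
  have hfactor (a : m) (b : n) : A i a b * α = c * (B i a b * β) := by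
    have hab := congrFun₂ h (Function.update (fun j => (p j).1) i a)
      (Function.update (fun j => (p j).2) i b)
    rwa [Matrix.smul_apply, piKronecker_apply_update, piKronecker_apply_update,
      smul_eq_mul] at hab
  have hβ : β ≠ 0 := Finset.prod_ne_zero_iff.2 fun j _ => hp j
  have hα : α ≠ 0 := right_ne_zero_of_mul
    ((hfactor (p i).1 (p i).2).trans_ne (mul_ne_zero hc (mul_ne_zero (hp i) hβ)))
  refine ⟨c * β / α, Matrix.ext fun a b => ?_⟩
  rw [Matrix.smul_apply, smul_eq_mul, div_mul_eq_mul_div, eq_div_iff hα, hfactor]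
  ring

end PiKronecker

theorem superOp_apply_eq_sum {n m : Type} [Fintype n] [DecidableEq n] (Φ : SuperOp n m)
    (M : Matrix n n ℂ) (a c : m) :
    Φ M a c = ∑ x, ∑ y, M x y * Φ (Matrix.single x y 1) a c := by
  have hsingle (x y : n) : Matrix.single x y (M x y) = M x y • Matrix.single x y (1 : ℂ) := by simp
  conv_lhs => rw [Matrix.matrix_eq_sum_single M]
  simp only [hsingle, map_sum, map_smul, Matrix.sum_apply, Matrix.smul_apply, smul_eq_mul]

theorem superOp_ext_piKronecker {ι n m : Type} [Fintype ι] [Finite n] {Φ Ψ : SuperOp (ι → n) m}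
    (h : ∀ M : ι → Matrix n n ℂ, Φ (piKronecker M) = Ψ (piKronecker M)) : Φ = Ψ := by
  classical
  have := Fintype.ofFinite n
  ext M a c
  rw [superOp_apply_eq_sum Φ, superOp_apply_eq_sum Ψ]
  simp only [← piKronecker_single, h]

section TensorPi

variable {ι n m l : Type} [Fintype ι] [DecidableEq ι] [Fintype n] [DecidableEq n]

/-- The tensor product `⨂ i, Φ i` of a family of superoperators; `tensorPower` is the case of a
constant family. -/
def tensorPi (Φ : ι → SuperOp n m) : SuperOp (ι → n) (ι → m) where
  toFun ρ := Matrix.of fun a c => ∑ x : ι → n, ∑ y : ι → n,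
    ρ x y * ∏ i, Φ i (Matrix.single (x i) (y i) 1) (a i) (c i)
  map_add' ρ τ := by
    ext a c
    simp [add_mul, Finset.sum_add_distrib]
  map_smul' r ρ := by
    ext a c
    simp [mul_assoc, Finset.mul_sum]

theorem tensorPower_eq_tensorPi (Φ : SuperOp (Fin 2) (Fin 2)) :
    tensorPower ι Φ = tensorPi fun _ => Φ := rfl

theorem tensorPi_piKronecker (Φ : ι → SuperOp n m) (M : ι → Matrix n n ℂ) :
    tensorPi Φ (piKronecker M) = piKronecker fun i => Φ i (M i) := by
  ext a c
  simp only [tensorPi, LinearMap.coe_mk, AddHom.coe_mk, Matrix.of_apply, piKronecker_apply,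
    ← Finset.prod_mul_distrib, superOp_apply_eq_sum _ (M _), Finset.prod_univ_sum,
    Fintype.piFinset_univ]

theorem tensorPi_comp [Fintype m] [DecidableEq m] (Φ : ι → SuperOp m l) (Ψ : ι → SuperOp n m) :
    tensorPi Φ ∘ₗ tensorPi Ψ = tensorPi fun i => Φ i ∘ₗ Ψ i :=
  superOp_ext_piKronecker fun M => by simp only [LinearMap.comp_apply, tensorPi_piKronecker]

theorem tensorPi_conjBy (A : ι → Matrix m n ℂ) :
    tensorPi (fun i => conjBy (A i)) = conjBy (piKronecker A) :=
  superOp_ext_piKronecker fun M => by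
    simp only [tensorPi_piKronecker, conjBy_apply, piKronecker_mul, piKronecker_conjTranspose]

theorem tensorPi_sum_smul {κ : Type*} [Fintype κ] (c : ι → κ → ℂ) (Φ : ι → κ → SuperOp n m) :
    tensorPi (fun i => ∑ k, c i k • Φ i k) =
      ∑ f : ι → κ, (∏ i, c i (f i)) • tensorPi fun i => Φ i (f i) :=
  superOp_ext_piKronecker fun M => by
    simp [tensorPi_piKronecker, piKronecker_sum, piKronecker_smul]

end TensorPi

/-! ### Isometries and global phases -/

theorem IsIsometry.conjTranspose_mul_cancel {l m n : Type*} [Fintype l] [Fintype m]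
    [DecidableEq m] {A : Matrix l m ℂ} (hA : IsIsometry A) (B : Matrix m n ℂ) :
    Aᴴ * (A * B) = B := by
  rw [← Matrix.mul_assoc, show Aᴴ * A = 1 from hA, Matrix.one_mul]

section Isometry

variable {l m n ι : Type*} [Fintype l] [Fintype m] [Fintype ι] [DecidableEq n]

theorem IsIsometry.mul [DecidableEq m] {A : Matrix l m ℂ} {B : Matrix m n ℂ}
    (hA : IsIsometry A) (hB : IsIsometry B) : IsIsometry (A * B) := by
  rw [IsIsometry, Matrix.conjTranspose_mul, Matrix.mul_assoc, hA.conjTranspose_mul_cancel, hB]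

theorem IsIsometry.piKronecker [DecidableEq ι] {A : ι → Matrix m n ℂ}
    (hA : ∀ i, IsIsometry (A i)) : IsIsometry (piKronecker A) := by
  unfold IsIsometry at hA ⊢
  simp only [piKronecker_conjTranspose, piKronecker_mul, hA, piKronecker_one]

theorem IsIsometry.ne_zero [Nonempty n] {A : Matrix m n ℂ} (hA : IsIsometry A) : A ≠ 0 := by
  rintro rfl
  inhabit n
  simpa [IsIsometry] using congrFun₂ hA default default

theorem IsIsometry.norm_eq_one_of_smul [Nonempty n] {A : Matrix m n ℂ} {c : ℂ}
    (hA : IsIsometry A) (hcA : IsIsometry (c • A)) : ‖c‖ = 1 := by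
  inhabit n
  unfold IsIsometry at hA hcA
  rw [Matrix.conjTranspose_smul, Matrix.smul_mul, Matrix.mul_smul, hA, smul_smul] at hcA
  have hentry := congrFun₂ hcA default default
  simp only [Matrix.smul_apply, Matrix.one_apply_eq, smul_eq_mul, mul_one, Complex.star_def,
    Complex.conj_mul'] at hentry
  exact (pow_eq_one_iff_of_nonneg (norm_nonneg c) two_ne_zero).1 (by exact_mod_cast hentry)

end Isometry

/-- `A` and `B` are the same operator up to a global phase. -/
def EqUpToPhase {m n : Type*} (A B : Matrix m n ℂ) : Prop :=
  ∃ c : ℂ, ‖c‖ = 1 ∧ A = c • B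

namespace EqUpToPhase

section Basic

variable {l m n ι : Type*} {A B C : Matrix m n ℂ}

protected theorem refl (A : Matrix m n ℂ) : EqUpToPhase A A :=
  ⟨1, norm_one, (one_smul ℂ A).symm⟩

protected theorem symm (h : EqUpToPhase A B) : EqUpToPhase B A := by
  obtain ⟨c, hc, rfl⟩ := h
  have hc0 : c ≠ 0 := norm_ne_zero_iff.1 (hc.trans_ne one_ne_zero)
  exact ⟨c⁻¹, by rw [norm_inv, hc, inv_one], (inv_smul_smul₀ hc0 B).symm⟩

protected theorem trans (hAB : EqUpToPhase A B) (hBC : EqUpToPhase B C) : EqUpToPhase A C := by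
  obtain ⟨c, hc, rfl⟩ := hAB
  obtain ⟨d, hd, rfl⟩ := hBC
  exact ⟨c * d, by rw [norm_mul, hc, hd, one_mul], smul_smul c d C⟩

theorem mul_left [Fintype m] (h : EqUpToPhase A B) (D : Matrix l m ℂ) :
    EqUpToPhase (D * A) (D * B) := by
  obtain ⟨c, hc, rfl⟩ := h
  exact ⟨c, hc, Matrix.mul_smul D c B⟩

theorem mul_right [Fintype n] (h : EqUpToPhase A B) (D : Matrix n l ℂ) :
    EqUpToPhase (A * D) (B * D) := by
  obtain ⟨c, hc, rfl⟩ := h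
  exact ⟨c, hc, Matrix.smul_mul c B D⟩

theorem submatrix (h : EqUpToPhase A B) {m' n' : Type*} (f : m' → m) (g : n' → n) :
    EqUpToPhase (A.submatrix f g) (B.submatrix f g) := by
  obtain ⟨c, hc, rfl⟩ := h
  exact ⟨c, hc, rfl⟩

theorem eq_zero_iff (h : EqUpToPhase A B) : A = 0 ↔ B = 0 := by
  obtain ⟨c, hc, rfl⟩ := h
  exact smul_eq_zero_iff_right (norm_ne_zero_iff.1 (hc.trans_ne one_ne_zero))

theorem piKronecker [Fintype ι] {A B : ι → Matrix m n ℂ} (h : ∀ i, EqUpToPhase (A i) (B i)) :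
    EqUpToPhase (piKronecker A) (piKronecker B) := by
  choose c hc h using h
  refine ⟨∏ i, c i, by simp [norm_prod, hc], ?_⟩
  rw [funext h, piKronecker_smul]

theorem of_mul_left [Fintype l] [Fintype m] [DecidableEq m] {D : Matrix l m ℂ}
    (hD : IsIsometry D) (h : EqUpToPhase (D * A) (D * B)) : EqUpToPhase A B := by
  simpa only [hD.conjTranspose_mul_cancel] using h.mul_left Dᴴ

theorem of_piKronecker [Fintype m] [DecidableEq n] [Nonempty n] [Fintype ι]
    {A B : ι → Matrix m n ℂ} (hA : ∀ i, IsIsometry (A i)) (hB : ∀ i, IsIsometry (B i))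
    (h : EqUpToPhase (QTree.piKronecker A) (QTree.piKronecker B)) (i : ι) :
    EqUpToPhase (A i) (B i) := by
  obtain ⟨c, hc, h⟩ := h
  obtain ⟨d, hd⟩ := exists_eq_smul_of_piKronecker_eq_smul
    (norm_ne_zero_iff.1 (hc.trans_ne one_ne_zero)) (fun j => (hB j).ne_zero) h i
  exact ⟨d, (hB i).norm_eq_one_of_smul (hd ▸ hA i), hd⟩

end Basic

theorem conjBy_eq {m n : Type} [Fintype n] {A B : Matrix m n ℂ} (h : EqUpToPhase A B) :
    conjBy A = conjBy B := by
  obtain ⟨c, hc, rfl⟩ := h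
  exact conjBy_smul hc B

end EqUpToPhase

/-! ### Pauli channels -/

namespace Pauli

theorem matrix_conjTranspose (a : Pauli) : a.matrixᴴ = a.matrix := by
  cases a <;> ext i j <;> fin_cases i <;> fin_cases j <;> simp [matrix]

theorem matrix_mul_self (a : Pauli) : a.matrix * a.matrix = 1 := by
  cases a <;> ext i j <;> fin_cases i <;> fin_cases j <;>
    simp [matrix, Matrix.mul_apply, Fin.sum_univ_two]

theorem isIsometry_matrix (a : Pauli) : IsIsometry a.matrix := by
  rw [IsIsometry, matrix_conjTranspose, matrix_mul_self]

instance : Fintype Pauli where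
  elems := {.I, .X, .Y, .Z}
  complete a := by cases a <;> decide

theorem sum_eq {M : Type*} [AddCommMonoid M] (f : Pauli → M) :
    ∑ a, f a = f .I + (f .X + (f .Y + f .Z)) := by
  change ∑ a ∈ ({.I, .X, .Y, .Z} : Finset Pauli), f a = _
  simp

/-- The label of `σ_a σ_b`, which is a Pauli matrix up to a phase. -/
def mul : Pauli → Pauli → Pauli
  | .I, a | a, .I => a
  | .X, .X | .Y, .Y | .Z, .Z => .I
  | .X, .Y | .Y, .X => .Z
  | .Y, .Z | .Z, .Y => .X
  | .Z, .X | .X, .Z => .Y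

theorem mul_comm (a b : Pauli) : a.mul b = b.mul a := by
  cases a <;> cases b <;> rfl

theorem matrix_mul_matrix (a b : Pauli) :
    EqUpToPhase (a.matrix * b.matrix) (a.mul b).matrix := by
  cases a <;> cases b
  case X.Y | Y.Z | Z.X =>
    refine ⟨Complex.I, by simp, ?_⟩
    ext i j
    fin_cases i <;> fin_cases j <;> simp [matrix, mul]
  case Y.X | Z.Y | X.Z =>
    refine ⟨-Complex.I, by simp, ?_⟩
    ext i j
    fin_cases i <;> fin_cases j <;> simp [matrix, mul]
  all_goals
    refine ⟨1, norm_one, ?_⟩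
    ext i j
    fin_cases i <;> fin_cases j <;> simp [matrix, mul]

theorem eq_of_eqUpToPhase {a b : Pauli} (h : EqUpToPhase a.matrix b.matrix) : a = b := by
  obtain ⟨c, -, h⟩ := h
  have h00 := congrFun₂ h 0 0
  have h01 := congrFun₂ h 0 1
  have h10 := congrFun₂ h 1 0
  have h11 := congrFun₂ h 1 1
  cases a <;> cases b <;> simp [matrix] at h00 h01 h10 h11 ⊢ <;> grind [Complex.I_ne_zero]

/-- The power `σ_a ^ x` for a bit `x`. -/
def pow (a : Pauli) (x : Bool) : Pauli := if x then a else .I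

end Pauli

theorem conjBy_matrix_conjBy_matrix (a b : Pauli) (ρ : Matrix (Fin 2) (Fin 2) ℂ) :
    conjBy a.matrix (conjBy b.matrix ρ) = conjBy (a.mul b).matrix ρ := by
  rw [← (a.matrix_mul_matrix b).conjBy_eq, ← conjBy_comp, LinearMap.comp_apply]

theorem conjBy_I : conjBy Pauli.I.matrix = LinearMap.id := conjBy_one

/-- Pauli channels, that is, random mixtures of conjugations by Pauli matrices. -/
def IsPauliChannel (Φ : SuperOp (Fin 2) (Fin 2)) : Prop :=
  ∃ π ∈ stdSimplex ℝ Pauli, Φ = ∑ a, (π a : ℂ) • conjBy a.matrix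

theorem isPauliChannel_conjBy (a : Pauli) : IsPauliChannel (conjBy a.matrix) :=
  ⟨Pi.single a 1, single_mem_stdSimplex ℝ a, by simp [Pi.single_apply, apply_ite, ite_smul]⟩

theorem isPauliChannel_sum_smul {κ : Type*} [Fintype κ] {c : κ → ℝ} (hc : c ∈ stdSimplex ℝ κ)
    {Φ : κ → SuperOp (Fin 2) (Fin 2)} (hΦ : ∀ k, IsPauliChannel (Φ k)) :
    IsPauliChannel (∑ k, (c k : ℂ) • Φ k) := by
  choose π hπ hΦ using hΦ
  refine ⟨_, sum_mul_mem_stdSimplex hc hπ, ?_⟩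
  simp only [hΦ, Finset.smul_sum, smul_smul, Complex.ofReal_sum, Complex.ofReal_mul,
    Finset.sum_smul]
  exact Finset.sum_comm

theorem IsPauliChannel.comp {Φ Ψ : SuperOp (Fin 2) (Fin 2)} (hΦ : IsPauliChannel Φ)
    (hΨ : IsPauliChannel Ψ) : IsPauliChannel (Φ ∘ₗ Ψ) := by
  obtain ⟨π, hπ, rfl⟩ := hΦ
  obtain ⟨ρ, hρ, rfl⟩ := hΨ
  convert isPauliChannel_sum_smul hπ fun a =>
    isPauliChannel_sum_smul hρ fun b => isPauliChannel_conjBy (a.mul b)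
  ext1 τ
  simp only [LinearMap.comp_apply, LinearMap.sum_apply, LinearMap.smul_apply]
  simp only [map_sum, map_smul, conjBy_matrix_conjBy_matrix]

theorem IsPauliChannel.comp_conjBy_comm {Φ : SuperOp (Fin 2) (Fin 2)} (hΦ : IsPauliChannel Φ)
    (a : Pauli) : Φ ∘ₗ conjBy a.matrix = conjBy a.matrix ∘ₗ Φ := by
  obtain ⟨π, -, rfl⟩ := hΦ
  ext1 ρ
  simp only [LinearMap.comp_apply, LinearMap.sum_apply, LinearMap.smul_apply, map_sum, map_smul,
    conjBy_matrix_conjBy_matrix, a.mul_comm]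

/-- The operator `⨂ i, σ_{s i}`, with phase `1`. -/
def stringMatrix {ι : Type} [Fintype ι] (s : ι → Pauli) : Matrix (ι → Fin 2) (ι → Fin 2) ℂ :=
  piKronecker fun i => (s i).matrix

theorem eq_of_eqUpToPhase_stringMatrix {ι : Type} [Fintype ι] {s s' : ι → Pauli}
    (h : EqUpToPhase (stringMatrix s) (stringMatrix s')) : s = s' :=
  funext fun i => Pauli.eq_of_eqUpToPhase
    (.of_piKronecker (fun j => (s j).isIsometry_matrix) (fun j => (s' j).isIsometry_matrix) h i)

section Strings

variable {ι : Type} [Fintype ι] [DecidableEq ι]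

theorem isIsometry_stringMatrix (s : ι → Pauli) : IsIsometry (stringMatrix s) :=
  .piKronecker fun i => (s i).isIsometry_matrix

theorem isChannel_tensorPi {Φ : ι → SuperOp (Fin 2) (Fin 2)} (hΦ : ∀ i, IsPauliChannel (Φ i)) :
    IsChannel (tensorPi Φ) := by
  choose π hπ hΦ using hΦ
  rw [funext hΦ, tensorPi_sum_smul]
  simp only [tensorPi_conjBy, ← Complex.ofReal_prod]
  exact .sum_smul (prod_mem_stdSimplex hπ) fun s => isChannel_conjBy (isIsometry_stringMatrix s)

end Strings

/-! ### Splitting a flip off the noise -/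

section PauliFlip

variable {N R : SuperOp (Fin 2) (Fin 2)} {a : Pauli} {q : ℝ}

theorem pauliFlip_I (q : ℝ) : pauliFlip .I q = LinearMap.id := by
  rw [pauliFlip, conjBy_I, ← add_smul, ← Complex.ofReal_add, sub_add_cancel, Complex.ofReal_one,
    one_smul]

theorem pauliFlip_comp_conjBy_pow (a : Pauli) (q : ℝ) (x : Bool) :
    pauliFlip a q ∘ₗ conjBy (a.pow x).matrix =
      ∑ y, (bsc q x y : ℂ) • conjBy (a.pow y).matrix := by
  ext1 ρ
  cases x
  · simp [pauliFlip, bsc, Pauli.pow, conjBy_I, add_comm]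
  · have hsq : a.mul a = .I := by cases a <;> rfl
    simp [pauliFlip, bsc, Pauli.pow, conjBy_I, conjBy_matrix_conjBy_matrix, hsq]

theorem isPauliChannel_pauliFlip (a : Pauli) (hq : q ∈ Set.Icc (0 : ℝ) 1) :
    IsPauliChannel (pauliFlip a q) := by
  have hmixture := pauliFlip_comp_conjBy_pow a q false
  rw [show a.pow false = .I from rfl, conjBy_I, LinearMap.comp_id] at hmixture
  exact hmixture ▸ isPauliChannel_sum_smul (bsc_mem_stdSimplex hq false) fun y =>
    isPauliChannel_conjBy (a.pow y)

/-- The noise `N` consists of a Pauli channel followed by a flip along `a` with probability `q`. -/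
def HasFlipFactor (N : SuperOp (Fin 2) (Fin 2)) (a : Pauli) (q : ℝ) : Prop :=
  ∃ R, IsPauliChannel R ∧ N = pauliFlip a q ∘ₗ R

theorem HasFlipFactor.isPauliChannel (h : HasFlipFactor N a q) (hq : q ∈ Set.Icc (0 : ℝ) 1) :
    IsPauliChannel N := by
  obtain ⟨R, hR, rfl⟩ := h
  exact (isPauliChannel_pauliFlip a hq).comp hR

theorem IsPauliChannel.hasFlipFactor_I (hN : IsPauliChannel N) (q : ℝ) : HasFlipFactor N .I q :=
  ⟨N, hN, by rw [pauliFlip_I, LinearMap.id_comp]⟩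

theorem IsPauliChannel.hasFlipFactor_comp (hR : IsPauliChannel R) (a : Pauli) (q : ℝ) :
    HasFlipFactor (R ∘ₗ pauliFlip a q) a q := by
  refine ⟨R, hR, ?_⟩
  simp only [pauliFlip, LinearMap.comp_add, LinearMap.add_comp, LinearMap.comp_smul,
    LinearMap.smul_comp, LinearMap.comp_id, LinearMap.id_comp, hR.comp_conjBy_comm]

theorem sum_conjBy_matrix_apply (ρ : Matrix (Fin 2) (Fin 2) ℂ) :
    ∑ a : Pauli, conjBy a.matrix ρ = (2 * ρ.trace) • 1 := by
  rw [Pauli.sum_eq, conjBy_I]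
  ext i j
  simp only [LinearMap.id_apply, Matrix.add_apply, conjBy_apply, Pauli.matrix_conjTranspose,
    Matrix.mul_apply, Fin.sum_univ_two, Matrix.smul_apply, Matrix.trace_fin_two]
  fin_cases i <;> fin_cases j <;> simp [Pauli.matrix, mul_right_comm] <;> ring

theorem depolarizing_eq_add_sum_conjBy (ε : ℝ) :
    depolarizing ε =
      (1 - ε : ℂ) • LinearMap.id + (ε / 4 : ℂ) • ∑ a : Pauli, conjBy a.matrix := by
  ext1 ρ
  simp only [depolarizing, LinearMap.add_apply, LinearMap.smul_apply, LinearMap.sum_apply,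
    LinearMap.smulRight_apply, Matrix.traceLinearMap_apply, sum_conjBy_matrix_apply,
    Complex.ofReal_sub, Complex.ofReal_one]
  module

theorem hasFlipFactor_depolarizing {ε : ℝ} (h0 : 0 ≤ ε) (h1 : ε ≤ 4 / 3) (ha : a ≠ .I) :
    HasFlipFactor (depolarizing ε) a (ε / (2 * (2 - ε))) := by
  have hε : (2 : ℂ) - ε ≠ 0 := by exact_mod_cast (by linarith : (0 : ℝ) < 2 - ε).ne'
  refine ⟨_, ⟨fun c => if c = .I then 1 - ε / 2 else if c = a then 0 else ε / 4,
    ⟨fun c => by dsimp only; split_ifs <;> linarith, ?_⟩, rfl⟩, LinearMap.ext fun ρ => ?_⟩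
  · cases a <;> simp [Pauli.sum_eq] at ha ⊢ <;> ring
  · cases a
    case I => contradiction
    all_goals
      simp only [depolarizing_eq_add_sum_conjBy, pauliFlip, Pauli.sum_eq, conjBy_I,
        LinearMap.comp_apply, LinearMap.add_apply, LinearMap.smul_apply, LinearMap.id_apply,
        map_add, map_smul, conjBy_matrix_conjBy_matrix, Pauli.mul, reduceCtorEq, if_false, if_true,
        Complex.ofReal_sub, Complex.ofReal_div, Complex.ofReal_mul, Complex.ofReal_zero,
        Complex.ofReal_one, Complex.ofReal_ofNat]
      match_scalars <;> field_simp <;> ring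

theorem hasFlipFactor_pauliFlip_Z_comp_pauliFlip_X {p : ℝ} (hp : p ∈ Set.Icc (0 : ℝ) 1)
    (hI : a ≠ .I) (hY : a ≠ .Y) : HasFlipFactor (pauliFlip .Z p ∘ₗ pauliFlip .X p) a p := by
  cases a
  case X => exact (isPauliChannel_pauliFlip .Z hp).hasFlipFactor_comp .X p
  case Z => exact ⟨_, isPauliChannel_pauliFlip .X hp, rfl⟩
  all_goals contradiction

end PauliFlip

/-- Conjugation by the string `s`, raised site by site to a random pattern of bits with
weights `P`. -/
def randomPower {ι : Type} [Fintype ι] [DecidableEq ι] (s : ι → Pauli) (P : (ι → Bool) → ℝ) :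
    SuperOp (ι → Fin 2) (ι → Fin 2) :=
  ∑ y, (P y : ℂ) • conjBy (stringMatrix fun i => (s i).pow (y i))

theorem exists_tensorPower_comp_conjBy_pow {ι : Type} [Fintype ι] [DecidableEq ι]
    {N : SuperOp (Fin 2) (Fin 2)} {a : ι → Pauli} {q : ι → ℝ}
    (hN : ∀ i, HasFlipFactor N (a i) (q i)) :
    ∃ R, IsChannel R ∧ ∀ y : ι → Bool,
      tensorPower ι N ∘ₗ conjBy (stringMatrix fun i => (a i).pow (y i)) =
        randomPower a (fun y' => ∏ i, bsc (q i) (y i) (y' i)) ∘ₗ R := by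
  choose R hR hNR using hN
  refine ⟨tensorPi R, isChannel_tensorPi hR, fun y => ?_⟩
  have hsite : ∀ i, N ∘ₗ conjBy ((a i).pow (y i)).matrix =
      (∑ y', (bsc (q i) (y i) y' : ℂ) • conjBy ((a i).pow y').matrix) ∘ₗ R i := fun i => by
    rw [← pauliFlip_comp_conjBy_pow, LinearMap.comp_assoc, ← (hR i).comp_conjBy_comm,
      ← LinearMap.comp_assoc, ← hNR i]
  rw [tensorPower_eq_tensorPi, stringMatrix, ← tensorPi_conjBy, tensorPi_comp, funext hsite,
    ← tensorPi_comp, tensorPi_sum_smul]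
  simp only [tensorPi_conjBy, randomPower, stringMatrix, Complex.ofReal_prod]

/-! ### Encoders -/

theorem IsIsometry.submatrix {m n m' n' : Type*} [Fintype m] [Fintype m'] [DecidableEq n]
    [DecidableEq n'] {A : Matrix m n ℂ} (hA : IsIsometry A) (e : m' ≃ m) {f : n' → n}
    (hf : Function.Injective f) : IsIsometry (A.submatrix e f) := by
  rw [IsIsometry, Matrix.conjTranspose_submatrix, Matrix.submatrix_mul_equiv,
    show Aᴴ * A = 1 from hA, Matrix.submatrix_one _ hf]

/-- The string `s` acts on the output of the encoder `V` as the Pauli matrix `a` on its input, up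
to a phase. -/
def ActsAs {ι : Type} [Fintype ι] [DecidableEq ι] (V : Matrix (ι → Fin 2) (Fin 2) ℂ)
    (s : ι → Pauli) (a : Pauli) : Prop :=
  EqUpToPhase (stringMatrix s * V) (V * a.matrix)

theorem ActsAs.pow {ι : Type} [Fintype ι] [DecidableEq ι] {V : Matrix (ι → Fin 2) (Fin 2) ℂ}
    {s : ι → Pauli} {a : Pauli} (h : ActsAs V s a) (x : Bool) :
    ActsAs V (fun i => (s i).pow x) (a.pow x) := by
  cases x
  · have hone : stringMatrix (fun _ : ι => Pauli.I) = 1 := piKronecker_one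
    simpa only [ActsAs, Pauli.pow, Bool.false_eq_true, if_false, hone, Matrix.one_mul,
      Pauli.matrix, Matrix.mul_one] using EqUpToPhase.refl V
  · exact h

section RootIso

variable {b : ℕ}

theorem rootIso_eq_submatrix (b : ℕ) : rootIso b =
    (1 : Matrix (Fin 2) (Fin 2) ℂ).submatrix (Equiv.funUnique (Level b 0) (Fin 2)) id := by
  ext x k
  simp only [rootIso, Matrix.of_apply, Matrix.submatrix_apply, Matrix.one_apply, id,
    Equiv.funUnique_apply, Subsingleton.elim (default : Level b 0) Fin.elim0]

theorem isIsometry_rootIso (b : ℕ) : IsIsometry (rootIso b) := by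
  rw [rootIso_eq_submatrix]
  exact IsIsometry.submatrix (by simp [IsIsometry]) _ Function.injective_id

theorem stringMatrix_mul_rootIso (s : Level b 0 → Pauli) :
    stringMatrix s * rootIso b = rootIso b * (s Fin.elim0).matrix := by
  set e := Equiv.funUnique (Level b 0) (Fin 2)
  set A := (s Fin.elim0).matrix with hA
  have hstring : stringMatrix s = A.submatrix e e := by
    ext x y
    rw [stringMatrix, piKronecker_apply, Fintype.prod_unique, hA,
      Subsingleton.elim Fin.elim0 default]
    rfl
  calc stringMatrix s * rootIso b = (A * 1).submatrix e id := by
        rw [hstring, rootIso_eq_submatrix, Matrix.submatrix_mul_equiv]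
    _ = ((1 : Matrix (Fin 2) (Fin 2) ℂ) * A).submatrix e id := by
        rw [Matrix.mul_one, Matrix.one_mul]
    _ = rootIso b * A := by
        rw [rootIso_eq_submatrix]
        rfl

end RootIso

section Encoders

variable {b : ℕ} [NeZero b]

section Encoder

/-- The basis state `|k⟩ ⊗ |0⟩^{⊗(b-1)}` of the input qubits of a node. -/
def dataState (b : ℕ) [NeZero b] (k : Fin 2) : Fin b → Fin 2 := Function.update (fun _ => 0) 0 k

theorem dataState_injective : Function.Injective (dataState b) :=
  fun k k' h => by simpa [dataState] using congrFun h 0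

/-- The embedding `|k⟩ ↦ |k⟩ ⊗ |0⟩^{⊗(b-1)}` of the data qubit, i.e. the encoder of the trivial
unitary. -/
def embedData (b : ℕ) [NeZero b] : Matrix (Fin b → Fin 2) (Fin 2) ℂ :=
  (1 : Matrix (Fin b → Fin 2) (Fin b → Fin 2) ℂ).submatrix (Equiv.refl _) (dataState b)

theorem mul_embedData_apply {m : Type*} (A : Matrix m (Fin b → Fin 2) ℂ) (x : m) (k : Fin 2) :
    (A * embedData b) x k = A x (dataState b k) := by
  simp [embedData, Matrix.mul_apply, Matrix.one_apply]

theorem encoder_eq_mul (V : Matrix (Fin b → Fin 2) (Fin b → Fin 2) ℂ) :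
    encoder V = V * embedData b :=
  Matrix.ext fun x k => (mul_embedData_apply V x k).symm

theorem isIsometry_encoder {V : Matrix (Fin b → Fin 2) (Fin b → Fin 2) ℂ}
    (hV : V ∈ Matrix.unitaryGroup (Fin b → Fin 2) ℂ) : IsIsometry (encoder V) :=
  IsIsometry.submatrix (Matrix.mem_unitaryGroup_iff'.1 hV) (Equiv.refl _) dataState_injective

theorem embedData_mul_apply (A : Matrix (Fin 2) (Fin 2) ℂ) (x : Fin b → Fin 2) (k : Fin 2) :
    (embedData b * A) x k = if ∀ j ≠ 0, x j = 0 then A (x 0) k else 0 := by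
  have hx (k : Fin 2) : x = dataState b k ↔ (∀ j ≠ 0, x j = 0) ∧ x 0 = k :=
    Function.eq_update_iff.trans and_comm
  simp only [Matrix.mul_apply, embedData, Matrix.submatrix_apply, Equiv.refl_apply,
    Matrix.one_apply, hx, ite_and, ite_mul, one_mul, zero_mul]
  split_ifs <;> simp

theorem conjTranspose_embedData_mul_apply {m : Type*} (A : Matrix (Fin b → Fin 2) m ℂ)
    (k : Fin 2) (y : m) : ((embedData b)ᴴ * A) k y = A (dataState b k) y := by
  simp [embedData, Matrix.mul_apply, Matrix.one_apply]

theorem stringMatrix_mul_embedData_apply (s : Fin b → Pauli) (x : Fin b → Fin 2) (k : Fin 2) :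
    (stringMatrix s * embedData b) x k =
      (s 0).matrix (x 0) k * ∏ j ∈ Finset.univ.erase 0, (s j).matrix (x j) 0 := by
  rw [mul_embedData_apply, stringMatrix, piKronecker_apply,
    ← Finset.mul_prod_erase _ _ (Finset.mem_univ 0), dataState, Function.update_self]
  refine congrArg _ (Finset.prod_congr rfl fun j hj => ?_)
  rw [Function.update_of_ne (Finset.ne_of_mem_erase hj)]

theorem Pauli.matrix_apply_zero_or (a : Pauli) :
    (∀ k, a.matrix k 0 = if k = 0 then 1 else 0) ∨ a.matrix 0 0 = 0 := by
  cases a <;> simp [Pauli.matrix, Fin.forall_fin_two]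

theorem stringMatrix_mul_embedData_eq_or (s : Fin b → Pauli) :
    stringMatrix s * embedData b = embedData b * (s 0).matrix ∨
      (embedData b)ᴴ * (stringMatrix s * embedData b) = 0 := by
  by_cases hs : ∀ j ≠ 0, ∀ k, (s j).matrix k 0 = if k = 0 then 1 else 0
  · left
    ext x k
    rw [stringMatrix_mul_embedData_apply, embedData_mul_apply,
      Finset.prod_congr rfl fun j hj => hs j (Finset.ne_of_mem_erase hj) (x j)]
    simp [Finset.prod_ite_zero]
  · right
    push Not at hs
    obtain ⟨j, hj, k, hk⟩ := hs
    have hzero := (s j).matrix_apply_zero_or.resolve_left fun h => hk (h k)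
    ext k' k
    rw [conjTranspose_embedData_mul_apply, stringMatrix_mul_embedData_apply,
      Finset.prod_eq_zero (i := j) (by simpa using hj), mul_zero, Matrix.zero_apply]
    rwa [dataState, Function.update_of_ne hj]

end Encoder

section Clifford

theorem PauliOp.eqUpToPhase_toMatrix {ι : Type} [Fintype ι] (P : PauliOp ι) :
    EqUpToPhase P.toMatrix (stringMatrix P.string) :=
  ⟨P.phase, Complex.norm_eq_one_of_pow_eq_one P.phase_pow four_ne_zero, rfl⟩

/- Conjugation by `V` permutes the strings, since it is injective and there are finitely many. -/
theorem IsClifford.exists_stringMatrix_mul_eqUpToPhase {ι : Type} [Fintype ι] [DecidableEq ι]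
    {V : Matrix (ι → Fin 2) (ι → Fin 2) ℂ} (hV : IsClifford V) (s : ι → Pauli) :
    ∃ s', EqUpToPhase (stringMatrix s * V) (V * stringMatrix s') := by
  have hisom : IsIsometry V := Matrix.mem_unitaryGroup_iff'.1 hV.1
  have himage (s : ι → Pauli) : ∃ s', EqUpToPhase (V * stringMatrix s) (stringMatrix s' * V) := by
    obtain ⟨Q, hQ⟩ := hV.2 ⟨1, one_pow 4, s⟩
    refine ⟨Q.string, ?_⟩
    have hstring : (⟨1, one_pow 4, s⟩ : PauliOp ι).toMatrix = stringMatrix s := one_smul ℂ _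
    have h := Q.eqUpToPhase_toMatrix.mul_right V
    rwa [← hQ, hstring, Matrix.mul_assoc, show Vᴴ * V = 1 from hisom, Matrix.mul_one] at h
  choose f hf using himage
  have hinj : Function.Injective f := fun s s' h =>
    eq_of_eqUpToPhase_stringMatrix (.of_mul_left hisom ((h ▸ hf s).trans (hf s').symm))
  obtain ⟨s', rfl⟩ := Finite.injective_iff_surjective.1 hinj s
  exact ⟨s', (hf s').symm⟩

/- The second alternative says that `s` maps the code space to its orthogonal complement. -/
theorem IsClifford.exists_actsAs_or_eq_zero {V : Matrix (Fin b → Fin 2) (Fin b → Fin 2) ℂ}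
    (hV : IsClifford V) (s : Fin b → Pauli) :
    (∃ a, ActsAs (encoder V) s a) ∨ (encoder V)ᴴ * (stringMatrix s * encoder V) = 0 := by
  obtain ⟨s', h⟩ := hV.exists_stringMatrix_mul_eqUpToPhase s
  have hisom : IsIsometry V := Matrix.mem_unitaryGroup_iff'.1 hV.1
  replace h := h.mul_right (embedData b)
  rw [Matrix.mul_assoc, ← encoder_eq_mul, Matrix.mul_assoc] at h
  refine (stringMatrix_mul_embedData_eq_or s').imp (fun hcode => ⟨s' 0, ?_⟩) fun horth => ?_
  · rwa [hcode, ← Matrix.mul_assoc, ← encoder_eq_mul] at h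
  · refine (h.mul_left (encoder V)ᴴ).eq_zero_iff.2 ?_
    rw [encoder_eq_mul V, Matrix.conjTranspose_mul, Matrix.mul_assoc,
      hisom.conjTranspose_mul_cancel, horth]

end Clifford

section Layer

variable {U : Unitaries b} {t : ℕ} {s : Level b (t + 1) → Pauli} {s' : Level b t → Pauli}

theorem layer_eq_submatrix (U : Unitaries b) (t : ℕ) : layer U t =
    (piKronecker fun v => encoder (U t v)).submatrix (childrenEquiv b t (Fin 2)) id := rfl

theorem isIsometry_layer (hU : ∀ v, U t v ∈ Matrix.unitaryGroup (Fin b → Fin 2) ℂ) :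
    IsIsometry (layer U t) :=
  (IsIsometry.piKronecker fun v => isIsometry_encoder (hU v)).submatrix
    (childrenEquiv b t (Fin 2)) Function.injective_id

theorem stringMatrix_mul_layer (U : Unitaries b) (s : Level b (t + 1) → Pauli) :
    stringMatrix s * layer U t = (piKronecker fun v =>
      stringMatrix (childrenEquiv b t Pauli s v) * encoder (U t v)).submatrix
        (childrenEquiv b t (Fin 2)) id := by
  have hs : stringMatrix s = (piKronecker fun v =>
      stringMatrix (childrenEquiv b t Pauli s v)).submatrix
        (childrenEquiv b t (Fin 2)) (childrenEquiv b t (Fin 2)) := by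
    ext x y
    exact prod_level_succ _
  rw [hs, layer_eq_submatrix, Matrix.submatrix_mul_equiv, piKronecker_mul]

theorem layer_mul_stringMatrix (U : Unitaries b) (s' : Level b t → Pauli) :
    layer U t * stringMatrix s' = (piKronecker fun v =>
      encoder (U t v) * (s' v).matrix).submatrix (childrenEquiv b t (Fin 2)) id := by
  rw [layer_eq_submatrix, stringMatrix, ← piKronecker_mul]
  rfl

theorem eqUpToPhase_stringMatrix_mul_layer
    (h : ∀ v, ActsAs (encoder (U t v)) (childrenEquiv b t Pauli s v) (s' v)) :
    EqUpToPhase (stringMatrix s * layer U t) (layer U t * stringMatrix s') := by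
  rw [stringMatrix_mul_layer, layer_mul_stringMatrix]
  exact (EqUpToPhase.piKronecker h).submatrix _ _

theorem actsAs_of_eqUpToPhase_stringMatrix_mul_layer
    (hU : ∀ v, U t v ∈ Matrix.unitaryGroup (Fin b → Fin 2) ℂ)
    (h : EqUpToPhase (stringMatrix s * layer U t) (layer U t * stringMatrix s')) (v : Level b t) :
    ActsAs (encoder (U t v)) (childrenEquiv b t Pauli s v) (s' v) := by
  rw [stringMatrix_mul_layer, layer_mul_stringMatrix] at h
  have hnode := h.submatrix (childrenEquiv b t (Fin 2)).symm id
  simp only [Matrix.submatrix_submatrix, Equiv.self_comp_symm, Function.comp_id,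
    Matrix.submatrix_id_id] at hnode
  exact hnode.of_piKronecker
    (fun v => (isIsometry_stringMatrix _).mul (isIsometry_encoder (hU v)))
    (fun v => (isIsometry_encoder (hU v)).mul (s' v).isIsometry_matrix) v

theorem conjTranspose_layer_mul_stringMatrix_mul_layer (U : Unitaries b)
    (s : Level b (t + 1) → Pauli) :
    (layer U t)ᴴ * (stringMatrix s * layer U t) = piKronecker fun v => (encoder (U t v))ᴴ *
      (stringMatrix (childrenEquiv b t Pauli s v) * encoder (U t v)) := by
  rw [stringMatrix_mul_layer, layer_eq_submatrix, Matrix.conjTranspose_submatrix,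
    Matrix.submatrix_mul_equiv, piKronecker_conjTranspose, piKronecker_mul,
    Matrix.submatrix_id_id]

theorem conjBy_layer_comp_conjBy_pow
    (h : ∀ v, ActsAs (encoder (U t v)) (childrenEquiv b t Pauli s v) (s' v))
    (z : Level b t → Bool) :
    conjBy (layer U t) ∘ₗ conjBy (stringMatrix fun v => (s' v).pow (z v)) =
      conjBy (stringMatrix fun u => (s u).pow (z (Fin.init u))) ∘ₗ conjBy (layer U t) := by
  rw [conjBy_comp, conjBy_comp]
  refine (eqUpToPhase_stringMatrix_mul_layer fun v => ?_).conjBy_eq.symm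
  convert (h v).pow (z v) with j
  rw [childrenEquiv_apply, childrenEquiv_apply, Fin.init_snoc]

end Layer

theorem isIsometry_concatEncoder {U : Unitaries b}
    (hU : ∀ t v, U t v ∈ Matrix.unitaryGroup (Fin b → Fin 2) ℂ) (T : ℕ) :
    IsIsometry (concatEncoder U T) := by
  induction T with
  | zero => exact isIsometry_rootIso b
  | succ T ih => exact (isIsometry_layer (hU T)).mul ih

end Encoders

/-! ### Chains of logical operators -/

section Chains

variable {b : ℕ} [NeZero b] {U : Unitaries b} {T : ℕ} {w : Pauli}

/-- The strings `s 0, …, s T` form a chain: the encoder at each node maps the letter at that node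
to the letters at its children. -/
def IsLogicalChain (U : Unitaries b) (T : ℕ) (s : (t : ℕ) → Level b t → Pauli) : Prop :=
  ∀ t < T, ∀ v, ActsAs (encoder (U t v)) (childrenEquiv b t Pauli (s (t + 1)) v) (s t v)

theorem HasYFreeChain.exists_isLogicalChain (hU : ∀ t v, U t v ∈ Matrix.unitaryGroup _ ℂ)
    {L : PauliOp (Level b T)} (h : HasYFreeChain U T w L) :
    ∃ s, IsLogicalChain U T s ∧ s 0 = (fun _ => w) ∧ s T = L.string ∧
      ∀ t ≤ T, ∀ u, s t u ≠ .Y := by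
  obtain ⟨C, hroot, rfl, hY, hC⟩ := h
  refine ⟨fun t => (C t).string, fun t ht => ?_, congrArg PauliOp.string hroot, rfl, hY⟩
  refine actsAs_of_eqUpToPhase_stringMatrix_mul_layer (hU t) ?_
  have hstring := (C (t + 1)).eqUpToPhase_toMatrix.mul_right (layer U t)
  rw [hC t ht] at hstring
  exact hstring.symm.trans ((C t).eqUpToPhase_toMatrix.mul_left _)

/- A logical operator preserves the code space, so at every node its string cannot map the local
code space to the orthogonal complement and must act as a Pauli matrix. -/
theorem ActsAs.exists_actsAs_concatEncoder (hU : ∀ t v, IsClifford (U t v))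
    {s : Level b (T + 1) → Pauli} (h : ActsAs (concatEncoder U (T + 1)) s w) :
    ∃ s', (∀ v, ActsAs (encoder (U T v)) (childrenEquiv b T Pauli s v) (s' v)) ∧
      ActsAs (concatEncoder U T) s' w := by
  have hlayer : IsIsometry (layer U T) := isIsometry_layer fun v => (hU T v).1
  rw [ActsAs, concatEncoder, Matrix.mul_assoc (layer U T), ← Matrix.mul_assoc _ (layer U T)] at h
  have hnode (v : Level b T) :
      ∃ a, ActsAs (encoder (U T v)) (childrenEquiv b T Pauli s v) a := by
    refine ((hU T v).exists_actsAs_or_eq_zero _).resolve_right fun horth => ?_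
    have hzero : (layer U T)ᴴ * (stringMatrix s * layer U T) = 0 := by
      rw [conjTranspose_layer_mul_stringMatrix_mul_layer]
      ext x y
      exact Finset.prod_eq_zero (Finset.mem_univ v) (congrFun₂ horth (x v) (y v))
    have hcode := h.mul_left (layer U T)ᴴ
    rw [← Matrix.mul_assoc, hzero, Matrix.zero_mul, hlayer.conjTranspose_mul_cancel] at hcode
    exact ((isIsometry_concatEncoder (fun t v => (hU t v).1) T).mul w.isIsometry_matrix).ne_zero
      (hcode.eq_zero_iff.1 rfl)
  choose s' hs' using hnode
  refine ⟨s', hs', .of_mul_left hlayer ?_⟩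
  rw [← Matrix.mul_assoc]
  exact ((eqUpToPhase_stringMatrix_mul_layer hs').mul_right _).symm.trans h

theorem ActsAs.exists_isLogicalChain (hU : ∀ t v, IsClifford (U t v)) {s : Level b T → Pauli}
    (h : ActsAs (concatEncoder U T) s w) :
    ∃ c, IsLogicalChain U T c ∧ c 0 = (fun _ => w) ∧ c T = s := by
  induction T with
  | zero =>
    refine ⟨fun _ _ => w, fun t ht => absurd ht t.not_lt_zero, rfl, funext fun v => ?_⟩
    rw [ActsAs, concatEncoder, stringMatrix_mul_rootIso, Subsingleton.elim Fin.elim0 v] at h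
    exact (Pauli.eq_of_eqUpToPhase (h.of_mul_left (isIsometry_rootIso b))).symm
  | succ T ih =>
    obtain ⟨s', hs', hlogical⟩ := h.exists_actsAs_concatEncoder hU
    obtain ⟨c, hc, hroot, rfl⟩ := ih hlogical
    refine ⟨Function.update c (T + 1) s, fun t ht => ?_, ?_, Function.update_self _ _ _⟩
    · rw [Function.update_of_ne ht.ne]
      rcases (Nat.lt_succ_iff.1 ht).eq_or_lt with rfl | ht
      · rwa [Function.update_self]
      · rw [Function.update_of_ne (by omega)]
        exact hc t ht
    · rwa [Function.update_of_ne T.succ_ne_zero.symm]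

theorem IsLogical.exists_isLogicalChain (hU : ∀ t v, IsClifford (U t v))
    {L : PauliOp (Level b T)} (h : IsLogical U T w L) :
    ∃ s, IsLogicalChain U T s ∧ s 0 = (fun _ => w) ∧ s T = L.string := by
  refine ActsAs.exists_isLogicalChain hU ?_
  have hstring := L.eqUpToPhase_toMatrix.symm.mul_right (concatEncoder U T)
  rwa [show L.toMatrix * concatEncoder U T = _ from h] at hstring

end Chains

/-! ### The noisy tree channel -/

section TreeChannel

variable {b T : ℕ} {s : (t : ℕ) → Level b t → Pauli}

theorem randomPower_broadcast_succ {q : (t : ℕ) → Level b (t + 1) → ℝ}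
    (a : Level b (T + 1) → Pauli) (x : Bool) :
    randomPower a (broadcast q (T + 1) x) = ∑ z, (broadcast q T x z : ℂ) •
      randomPower a fun y => ∏ u, bsc (q T u) (z (Fin.init u)) (y u) := by
  simp only [randomPower, broadcast, Complex.ofReal_sum, Complex.ofReal_mul, Finset.sum_smul,
    mul_smul, Finset.smul_sum]
  exact Finset.sum_comm

/-- The flip probability on the edge into a node whose letter is `a`, when the noise along the
other letters flips with probability `q₀`. Flips along `I` do nothing, so an edge into a letter
`I` may be taken to erase the bit completely. -/
def flipRate (q₀ : ℝ) (a : Pauli) : ℝ := if a = .I then 1 / 2 else q₀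

theorem flipRate_mem_Icc {q₀ : ℝ} (hq₀ : q₀ ∈ Set.Icc (0 : ℝ) 1) (a : Pauli) :
    flipRate q₀ a ∈ Set.Icc (0 : ℝ) 1 := by
  rw [flipRate]
  split_ifs
  · norm_num
  · exact hq₀

theorem sum_pathGain_flipRate_le (hroot : ∀ v, s 0 v ≠ .I) (q₀ : ℝ) :
    ∑ u, pathGain (fun t u => flipRate q₀ (s (t + 1) u)) T u ≤
      (1 - 2 * q₀) ^ (2 * T) * (Finset.univ.filter fun u => s T u ≠ .I).card := by
  rw [mul_comm _ (Nat.cast _), ← nsmul_eq_mul, ← Finset.sum_const, Finset.sum_filter]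
  refine Finset.sum_le_sum fun u _ => ?_
  split_ifs with hu
  · rw [pow_mul]
    refine pathGain_le_pow (fun t _ u => ?_) u
    rw [flipRate]
    split_ifs
    · norm_num [sq_nonneg]
    · exact le_rfl
  · cases T with
    | zero => exact absurd (hroot u) hu
    | succ T =>
      rw [pathGain, flipRate, if_pos (not_not.1 hu)]
      norm_num

variable [NeZero b] {U : Unitaries b} {N : SuperOp (Fin 2) (Fin 2)} {w : Pauli}

theorem IsLogicalChain.exists_treeChannel_comp_conjBy_pow (hs : IsLogicalChain U T s)
    (hU : ∀ t v, U t v ∈ Matrix.unitaryGroup _ ℂ) (hroot : s 0 = fun _ => w)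
    {q : (t : ℕ) → Level b (t + 1) → ℝ}
    (hN : ∀ t < T, ∀ u, HasFlipFactor N (s (t + 1) u) (q t u)) :
    ∃ R, IsChannel R ∧ ∀ x, treeChannel U N T ∘ₗ conjBy (w.pow x).matrix =
      randomPower (s T) (broadcast q T x) ∘ₗ R := by
  induction T with
  | zero =>
    refine ⟨conjBy (rootIso b), isChannel_conjBy (isIsometry_rootIso b), fun x => ?_⟩
    simp only [randomPower, broadcast, apply_ite Complex.ofReal, Complex.ofReal_one,
      Complex.ofReal_zero, ite_smul, one_smul, zero_smul, Finset.sum_ite_eq, Finset.mem_univ,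
      if_true, hroot, treeChannel, conjBy_comp, stringMatrix_mul_rootIso]
  | succ T ih =>
    obtain ⟨R, hR, htree⟩ := ih (fun t ht => hs t (ht.trans T.lt_succ_self))
      fun t ht => hN t (ht.trans T.lt_succ_self)
    obtain ⟨R', hR', hnoise⟩ := exists_tensorPower_comp_conjBy_pow (hN T T.lt_succ_self)
    have hlayer := isChannel_conjBy (isIsometry_layer (hU T))
    refine ⟨R' ∘ₗ conjBy (layer U T) ∘ₗ R, hR'.comp (hlayer.comp hR), fun x => ?_⟩
    have hstep (z : Level b T → Bool) :
        tensorPower _ N ∘ₗ conjBy (layer U T) ∘ₗ conjBy (stringMatrix fun v => (s T v).pow (z v)) =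
          randomPower (s (T + 1)) (fun y => ∏ u, bsc (q T u) (z (Fin.init u)) (y u)) ∘ₗ
            R' ∘ₗ conjBy (layer U T) := by
      rw [conjBy_layer_comp_conjBy_pow (hs T T.lt_succ_self), ← LinearMap.comp_assoc, hnoise,
        LinearMap.comp_assoc]
    ext1 ρ
    have htree' := LinearMap.congr_fun (htree x) ρ
    have hstep' z := LinearMap.congr_fun (hstep z) (R ρ)
    simp only [LinearMap.comp_apply] at htree' hstep'
    simp only [treeChannel, randomPower_broadcast_succ, LinearMap.comp_apply, htree',
      LinearMap.sum_apply, LinearMap.smul_apply, ← hstep']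
    simp only [randomPower, LinearMap.sum_apply, LinearMap.smul_apply, map_sum, map_smul]

theorem IsLogicalChain.sq_diamondNorm_sub_comp_dephase_le_sum_pathGain
    (hs : IsLogicalChain U T s) (hU : ∀ t v, U t v ∈ Matrix.unitaryGroup _ ℂ)
    (hroot : s 0 = fun _ => w) {q : (t : ℕ) → Level b (t + 1) → ℝ}
    (hq : ∀ t < T, ∀ u, q t u ∈ Set.Icc (0 : ℝ) 1)
    (hN : ∀ t < T, ∀ u, HasFlipFactor N (s (t + 1) u) (q t u)) :
    diamondNorm (treeChannel U N T - treeChannel U N T ∘ₗ dephase w) ^ 2 ≤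
      ∑ u, pathGain q T u := by
  obtain ⟨R, hR, htree⟩ := hs.exists_treeChannel_comp_conjBy_pow hU hroot hN
  have hmixture : treeChannel U N T - treeChannel U N T ∘ₗ dephase w =
      ∑ y, (((broadcast q T false y - broadcast q T true y) / 2 : ℝ) : ℂ) •
        (conjBy (stringMatrix fun u => (s T u).pow (y u)) ∘ₗ R) := by
    have hfalse := htree false
    rw [show w.pow false = .I from rfl, conjBy_I, LinearMap.comp_id] at hfalse
    have htrue := htree true
    rw [show w.pow true = w from rfl] at htrue
    rw [dephase, LinearMap.comp_smul, LinearMap.comp_add, LinearMap.comp_id, htrue, hfalse]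
    ext1 ρ
    simp only [randomPower, LinearMap.sub_apply, LinearMap.add_apply, LinearMap.smul_apply,
      LinearMap.comp_apply, LinearMap.sum_apply, ← Finset.sum_add_distrib, Finset.smul_sum,
      ← Finset.sum_sub_distrib]
    refine Finset.sum_congr rfl fun y _ => ?_
    push_cast
    module
  rw [hmixture]
  exact (pow_le_pow_left₀ (diamondNorm_nonneg _) (diamondNorm_sum_smul_le _ fun y =>
    (isChannel_conjBy (isIsometry_stringMatrix _)).comp hR) 2).trans
      (sq_sum_abs_half_sub_broadcast_le hq)

theorem IsLogicalChain.sq_diamondNorm_sub_comp_dephase_le (hs : IsLogicalChain U T s)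
    (hU : ∀ t v, U t v ∈ Matrix.unitaryGroup _ ℂ) (hroot : s 0 = fun _ => w) (hw : w ≠ .I)
    {q₀ : ℝ} (hq₀ : q₀ ∈ Set.Icc (0 : ℝ) 1)
    (hN : ∀ t ≤ T, ∀ u, s t u ≠ .I → HasFlipFactor N (s t u) q₀) :
    diamondNorm (treeChannel U N T - treeChannel U N T ∘ₗ dephase w) ^ 2 ≤
      (1 - 2 * q₀) ^ (2 * T) * (Finset.univ.filter fun u => s T u ≠ .I).card := by
  have hroot_ne : ∀ v, s 0 v ≠ .I := fun _ => hroot ▸ hw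
  have hpauli : IsPauliChannel N :=
    (hN 0 T.zero_le Fin.elim0 (hroot_ne _)).isPauliChannel hq₀
  refine (hs.sq_diamondNorm_sub_comp_dephase_le_sum_pathGain hU hroot
    (fun t _ u => flipRate_mem_Icc hq₀ _) fun t ht u => ?_).trans
      (sum_pathGain_flipRate_le hroot_ne q₀)
  by_cases hu : s (t + 1) u = .I
  · exact hu ▸ hpauli.hasFlipFactor_I _
  · rw [flipRate, if_neg hu]
    exact hN (t + 1) ht u hu

end TreeChannel

theorem mainTheorem4_general (b : ℕ) [NeZero b] (U : Unitaries b) (T : ℕ) (w : Pauli)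
    (hw : w ≠ .I) (L : PauliOp (Level b T)) :
    ((∀ t v, IsClifford (U t v)) → IsLogical U T w L → ∀ ε : ℝ, 0 ≤ ε → ε ≤ 4 / 3 →
      diamondNorm (treeChannel U (depolarizing ε) T -
          treeChannel U (depolarizing ε) T ∘ₗ dephase w) ^ 2 ≤
        (2 * (1 - ε) / (2 - ε)) ^ (2 * T) * L.weight) ∧
    ((∀ t v, U t v ∈ Matrix.unitaryGroup _ ℂ) → HasYFreeChain U T w L →
      ∀ p : ℝ, 0 ≤ p → p ≤ 1 →
        diamondNorm (treeChannel U (pauliFlip .Z p ∘ₗ pauliFlip .X p) T -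
            treeChannel U (pauliFlip .Z p ∘ₗ pauliFlip .X p) T ∘ₗ dephase w) ^ 2 ≤
          (1 - 2 * p) ^ (2 * T) * L.weight) := by
  refine ⟨fun hU hL ε h0 h1 => ?_, fun hU hL p h0 h1 => ?_⟩
  · obtain ⟨s, hs, hroot, hleaves⟩ := hL.exists_isLogicalChain hU
    have hε : 0 < 2 - ε := by linarith
    have hq : ε / (2 * (2 - ε)) ∈ Set.Icc (0 : ℝ) 1 :=
      ⟨by positivity, (div_le_one (by positivity)).2 (by linarith)⟩
    have hgain : 2 * (1 - ε) / (2 - ε) = 1 - 2 * (ε / (2 * (2 - ε))) := by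
      field_simp
      ring
    rw [PauliOp.weight, ← hleaves, hgain]
    exact hs.sq_diamondNorm_sub_comp_dephase_le (fun t v => (hU t v).1) hroot hw hq
      fun t _ u hu => hasFlipFactor_depolarizing h0 h1 hu
  · obtain ⟨s, hs, hroot, hleaves, hY⟩ := hL.exists_isLogicalChain hU
    rw [PauliOp.weight, ← hleaves]
    exact hs.sq_diamondNorm_sub_comp_dephase_le hU hroot hw ⟨h0, h1⟩
      fun t ht u hu => hasFlipFactor_pauliFlip_Z_comp_pauliFlip_X ⟨h0, h1⟩ hu (hY t ht u)

theorem pow_two_mul_two_mul_one_sub_div_two_sub_le {ε : ℝ} (h : ε ≤ 1) (T : ℕ) :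
    (2 * (1 - ε) / (2 - ε)) ^ (2 * T) ≤ (1 - ε) ^ T := by
  have hε : 0 < 2 - ε := by linarith
  have hsq : (2 * (1 - ε) / (2 - ε)) ^ 2 ≤ 1 - ε := by
    rw [div_pow, div_le_iff₀ (by positivity)]
    nlinarith [mul_nonneg (sub_nonneg.2 h) (sq_nonneg ε)]
  rw [pow_mul]
  exact pow_le_pow_left₀ (sq_nonneg _) hsq T

end QTree

end

theorem mainTheorem4 (b : ℕ) [NeZero b] (U : Unitaries b)
    (hU : ∀ (t : ℕ) (v : Level b t), IsClifford (U t v))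
    (T : ℕ) (w : Pauli) (hw : w ≠ Pauli.I)
    (L : PauliOp (Level b T)) (hL : IsLogical U T w L) :
    (∀ ε : ℝ, 0 ≤ ε → ε ≤ 1 →
      diamondNorm (treeChannel U (depolarizing ε) T -
          treeChannel U (depolarizing ε) T ∘ₗ dephase w) ^ 2 ≤
        2 * (1 - ε) ^ T * (L.weight : ℝ)) ∧
    (w ≠ Pauli.Y → HasYFreeChain U T w L →
      ∀ p : ℝ, 0 ≤ p → p ≤ 1 →
        diamondNorm (treeChannel U (pauliFlip Pauli.Z p ∘ₗ pauliFlip Pauli.X p) T -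
            treeChannel U (pauliFlip Pauli.Z p ∘ₗ pauliFlip Pauli.X p) T ∘ₗ dephase w) ^ 2 ≤
          2 * (1 - 2 * p) ^ (2 * T) * (L.weight : ℝ)) := by
  have hdouble {c d : ℝ} (hc : 0 ≤ c) (hd : d ≤ c * L.weight) : d ≤ 2 * c * L.weight :=
    hd.trans (by gcongr; exact le_mul_of_one_le_left hc one_le_two)
  obtain ⟨hdepolarizing, hflip⟩ := mainTheorem4_general b U T w hw L
  exact ⟨fun ε h0 h1 => hdouble (pow_nonneg (sub_nonneg.2 h1) T) <|
      (hdepolarizing hU hL ε h0 (by linarith)).trans (by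
        gcongr; exact pow_two_mul_two_mul_one_sub_div_two_sub_le h1 T),
    fun _ hchain p h0 h1 => hdouble ((even_two_mul T).pow_nonneg _) <|
      hflip (fun t v => (hU t v).1) hchain p h0 h1⟩
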